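/- Let $\mathrm{Top}_0$ be the category of $T_0$ topological spaces and continuous maps, with hom-sets ordered pointwise by the specialisation order ($x\le y$ iff every open set containing $x$ contains $y$). For a $T_0$ space $X$ let $FX$ be the space of all filters on the lattice $\Omega X$ of open sets, with topology generated by the sets $A^\#=\{\mathfrak f\mid A\in\mathfrak f\}$, $A\in\Omega X$. With $Ff(\mathfrak f)=\{B\mid f^{-1}(B)\in\mathfrak f\}$, unit $e_X(x)=\{U\in\Omega X\mid x\in U\}$ and multiplication $m_X(\mathfrak F)=\{A\mid A^\#\in\mathfrak F\}$ this is the filter monad $\mathbb F$. Restricting to proper filters ($\varnothing\notin\mathfrak f$), respectively prime filters (proper, and $U\cup V\in\mathfrak f$ implies $U\in\mathfrak f$ or $V\in\mathfrak f$), gives the proper filter monad $\mathbb F_1$ and the prime filter monad $\mathbb F_2$. Let $\mathbb T$ be one of these three monads. An algebra structure on a space is unique when it exists, so the Eilenberg--Moore category $\mathrm{Top}_0^{\mathbb T}$ is regarded as a (non-full) subcategory of $\mathrm{Top}_0$, with the inherited order on hom-sets. The Kleisli category $(\mathrm{Top}_0)_{\mathbb T}$ is regarded as the full subcategory of free algebras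 of $\mathrm{Top}_0^{\mathbb T}$. Let $S$ be the Sierpiński space, with its $\mathbb T$-algebra structure. Let $\mathrm{Hom}$ denote the hom-posets of $\mathrm{Top}_0^{\mathbb T}$ and $\pitchfork(P,S)$ the cotensor product in $\mathrm{Top}_0^{\mathbb T}$ of a poset $P$ with $S$. For a $\mathbb T$-algebra $X$ put $\hat X=\pitchfork(\mathrm{Hom}(X,S),S)$, with projections $\pi_f$, and let $\hat\pi_g$ be the projections of $\pitchfork(\mathrm{Hom}(\hat X,S),S)$. Define $n_X:X\to\hat X$ by $\pi_f n_X=f$ for all $f\in\mathrm{Hom}(X,S)$, and $\alpha,\beta:\hat X\to\pitchfork(\mathrm{Hom}(\hat X,S),S)$ by $\hat\pi_g\alpha=g$ and $\hat\pi_g\beta=\pi_{g n_X}$ for all $g\in\mathrm{Hom}(\hat X,S)$. Let $X_{\mathrm{alg}}$ be the full subcategory of $\mathrm{Top}_0^{\mathbb T}$ of those algebras $X$ for which $n_X$ is an equaliser of $\alpha$ and $\beta$ in $\mathrm{Top}_0$. Let $\mathrm{ALat}$ be the category of algebraic lattices, with maps preserving directed suprema and all infima; let $\mathrm{ADom}$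 be the category of bounded complete algebraic domains (the empty one included), with maps preserving directed suprema and all non-empty infima; both are regarded as subcategories of $\mathrm{Top}_0$ by means of the Scott topology. Let $\mathrm{Spec}$ be the category of spectral spaces and spectral maps. Then: (1) for $\mathbb T=\mathbb F,\mathbb F_1,\mathbb F_2$, the subcategory $X_{\mathrm{alg}}$ of $\mathrm{Top}_0$ is, respectively, $\mathrm{ALat}$, $\mathrm{ADom}$ and $\mathrm{Spec}$ (same objects and same morphisms); (2) in each of the three cases $X_{\mathrm{alg}}$ is the closure under weighted limits of $(\mathrm{Top}_0)_{\mathbb T}$ in $\mathrm{Top}_0^{\mathbb T}$, and also in $\mathrm{Top}_0$. Here weighted limits are those of order-enriched category theory, indexed by small order-enriched categories and weighted by order-enriched functors into posets. A subcategory $\mathcal A$ of an order-enriched category $\mathcal C$ is closed under weighted limits if, for every diagram in $\mathcal A$, each weighted limit of it in $\mathcal C$ lies in $\mathcal A$ together with its projections, and a morphism of $\mathcal C$ from an object of $\mathcal A$ to the limit lies in $\mathcal A$ as soon as its composites with all projections do. The closure of a subcategory is the least (not necessarily full) subcategory of $\mathcal C$ that contains it and is closed under weighted limits. -/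

import Mathlib

open CategoryTheory TopologicalSpace

universe v₁ v₂ v₃ u₁ u₂ u₃ w u

/-! ### Order-enriched categories, weighted limits, subcategories -/

/-- An order-enriched category: the hom-sets are posets and composition is monotone on both
sides. -/
class OrderEnriched (C : Type u₁) [Category.{v₁} C] where
  homOrder : ∀ X Y : C, PartialOrder (X ⟶ Y)
  comp_le_comp : ∀ {X Y Z : C} {f f' : X ⟶ Y} {g g' : Y ⟶ Z},
    f ≤ f' → g ≤ g' → f ≫ g ≤ f' ≫ g'

attribute [reducible, instance] OrderEnriched.homOrder

/-- An order-enriched functor: a functor which is monotone on each hom-poset. -/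
def IsOrderFunctor {C : Type u₁} [Category.{v₁} C] [OrderEnriched C] {D : Type u₂}
    [Category.{v₂} D] [OrderEnriched D] (F : C ⥤ D) : Prop :=
  ∀ ⦃X Y : C⦄ ⦃f g : X ⟶ Y⦄, f ≤ g → F.map f ≤ F.map g

/-- The category of posets and monotone maps, with the pointwise order on hom-sets. -/
instance PartOrd.orderEnriched : OrderEnriched PartOrd.{w} where
  homOrder X Y := PartialOrder.lift (fun f : X ⟶ Y => f.hom) (fun _ _ h => PartOrd.hom_ext h)
  comp_le_comp {_ _ _ _ f' g _} hf hg := fun x => (g.hom.monotone (hf x)).trans (hg (f' x))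

section WeightedLimits

variable {C : Type u₁} [Category.{v₁} C] [OrderEnriched C]

/-- The families `l_d^x : L ⟶ D d` (`d` an object, `x ∈ W d`) that correspond to natural
transformations from `W` to `C(L, D -)`. -/
structure IsWeightedCone {J : Type u₂} [Category.{v₂} J] (D : J ⥤ C) (W : J ⥤ PartOrd.{w})
    (L : C) (l : ∀ d : J, W.obj d → (L ⟶ D.obj d)) : Prop where
  mono : ∀ (d : J) (x y : W.obj d), x ≤ y → l d x ≤ l d y
  naturality : ∀ (d d' : J) (n : d ⟶ d') (x : W.obj d), l d x ≫ D.map n = l d' (W.map n x)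

/-- `L`, with the projections `l`, is the limit of `D` weighted by `W`. -/
structure IsWeightedLimit {J : Type u₂} [Category.{v₂} J] (D : J ⥤ C) (W : J ⥤ PartOrd.{w})
    (L : C) (l : ∀ d : J, W.obj d → (L ⟶ D.obj d)) : Prop extends IsWeightedCone D W L l where
  existsUnique_lift : ∀ (A : C) (a : ∀ d : J, W.obj d → (A ⟶ D.obj d)),
    IsWeightedCone D W A a → ∃! t : A ⟶ L, ∀ (d : J) (x : W.obj d), t ≫ l d x = a d x
  le_of_comp_le : ∀ (A : C) (t t' : A ⟶ L),
    (∀ (d : J) (x : W.obj d), t ≫ l d x ≤ t' ≫ l d x) → t ≤ t'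

/-- `L`, with the projections `π`, is the cotensor product of the poset `P` and the object `S`,
that is, the weighted limit over the unit category with diagram `S` and weight `P`. -/
structure IsCotensor (P : Type w) [PartialOrder P] (S L : C) (π : P → (L ⟶ S)) : Prop where
  mono : Monotone π
  existsUnique_lift : ∀ (A : C) (a : P → (A ⟶ S)), Monotone a → ∃! t : A ⟶ L, ∀ p, t ≫ π p = a p
  le_of_comp_le : ∀ (A : C) (t t' : A ⟶ L), (∀ p, t ≫ π p ≤ t' ≫ π p) → t ≤ t'

end WeightedLimits

/-- A (not necessarily full) subcategory of `C`. -/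
@[ext]
structure Subcategory (C : Type u₁) [Category.{v₁} C] where
  obj : ObjectProperty C
  hom : MorphismProperty C
  source_mem : ∀ {X Y : C} (f : X ⟶ Y), hom f → obj X
  target_mem : ∀ {X Y : C} (f : X ⟶ Y), hom f → obj Y
  id_mem : ∀ X : C, obj X → hom (𝟙 X)
  comp_mem : ∀ {X Y Z : C} (f : X ⟶ Y) (g : Y ⟶ Z), hom f → hom g → hom (f ≫ g)

namespace Subcategory

variable {C : Type u₁} [Category.{v₁} C] {D : Type u₂} [Category.{v₂} D]

/-- Inclusion of subcategories. -/
instance : PartialOrder (Subcategory C) :=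
  PartialOrder.lift (fun A => (A.obj, A.hom)) (fun A B h => by
    cases A; cases B; simp_all)

/-- The full subcategory determined by a class of objects. -/
def full (P : ObjectProperty C) : Subcategory C where
  obj := P
  hom := fun X Y _ => P X ∧ P Y
  source_mem _ h := h.1
  target_mem _ h := h.2
  id_mem _ h := ⟨h, h⟩
  comp_mem _ _ h h' := ⟨h.1, h'.2⟩

/-- The image of a subcategory of `C` under a functor `C ⥤ D` that is injective on objects. -/
def image (A : Subcategory C) (F : C ⥤ D) (hF : Function.Injective F.obj) : Subcategory D where
  obj := fun X => ∃ X' : C, A.obj X' ∧ F.obj X' = X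
  hom := fun X Y f => ∃ (X' Y' : C) (hX : F.obj X' = X) (hY : F.obj Y' = Y) (f' : X' ⟶ Y'),
    A.hom f' ∧ f = eqToHom hX.symm ≫ F.map f' ≫ eqToHom hY
  source_mem := by
    rintro X Y f ⟨X', Y', hX, hY, f', hf', -⟩
    exact ⟨X', A.source_mem f' hf', hX⟩
  target_mem := by
    rintro X Y f ⟨X', Y', hX, hY, f', hf', -⟩
    exact ⟨Y', A.target_mem f' hf', hY⟩
  id_mem := by
    rintro _ ⟨X', hX', rfl⟩
    exact ⟨X', X', rfl, rfl, 𝟙 X', A.id_mem X' hX', by simp⟩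
  comp_mem := by
    rintro X Y Z f g ⟨X', Y', rfl, rfl, f', hf', rfl⟩ ⟨Y'', Z', hY, rfl, g', hg', rfl⟩
    obtain rfl := hF hY
    exact ⟨X', Z', rfl, rfl, f' ≫ g', A.comp_mem f' g' hf' hg', by simp⟩

/-- The subcategory `A` of `D` contains all objects `F X` and all morphisms `F f`. -/
def ContainsImage (A : Subcategory D) (F : C ⥤ D) : Prop :=
  (∀ X : C, A.obj (F.obj X)) ∧ ∀ (X Y : C) (f : X ⟶ Y), A.hom (F.map f)

/-- `A` is closed under (small) weighted limits in `C`: whenever a diagram lies in `A`, every limit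
of it in `C`, for every weight, lies in `A` together with its projections, and it has in `A` the
universal property (a morphism of `C` from an object of `A` into the limit is in `A` as soon as its
composites with the projections are). -/
def ClosedUnderWeightedLimits [OrderEnriched C] (A : Subcategory C) : Prop :=
  ∀ (J : Type v₁) [SmallCategory J] [OrderEnriched J] (D : J ⥤ C) (W : J ⥤ PartOrd.{v₁}),
    IsOrderFunctor D → IsOrderFunctor W →
    A.ContainsImage D →
    ∀ (L : C) (l : ∀ d : J, W.obj d → (L ⟶ D.obj d)), IsWeightedLimit D W L l →
      A.obj L ∧ (∀ (d : J) (x : W.obj d), A.hom (l d x)) ∧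
        ∀ (B : C) (t : B ⟶ L), A.obj B → (∀ (d : J) (x : W.obj d), A.hom (t ≫ l d x)) → A.hom t

/-- `A` is the closure under weighted limits in `C` of the image of `F`: the least subcategory of
`C` which contains the image of `F` and is closed under weighted limits in `C`. -/
def IsWeightedLimitClosure {K : Type u₃} [Category.{v₃} K] [OrderEnriched C] (F : K ⥤ C)
    (A : Subcategory C) : Prop :=
  IsLeast {B : Subcategory C | B.ContainsImage F ∧ B.ClosedUnderWeightedLimits} A

end Subcategory

/-- The canonical functor from the Kleisli category to the Eilenberg–Moore category. -/
def kleisliToAlgebra {C : Type u₁} [Category.{v₁} C] (T : Monad C) : Kleisli T ⥤ T.Algebra where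
  obj X := T.free.obj X.of
  map {X Y} f :=
    { f := T.map f.of ≫ T.μ.app Y.of
      h := by simp [Monad.free, T.assoc, ← T.μ.naturality_assoc] }
  map_id X := by
    ext
    exact T.right_unit X.of
  map_comp {X Y Z} f g := by
    ext
    have h := T.μ.naturality g.of
    have h' := T.assoc Z.of
    dsimp at h h'
    change T.map (f.of ≫ T.map g.of ≫ T.μ.app Z.of) ≫ T.μ.app Z.of =
      (T.map f.of ≫ T.μ.app Y.of) ≫ T.map g.of ≫ T.μ.app Z.of
    simp only [Functor.map_comp, Category.assoc, h', reassoc_of% h]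

/-! ### The category of `T₀` spaces -/

/-- The category of `T₀` topological spaces and continuous maps. -/
abbrev Top0 : Type (u + 1) := ObjectProperty.FullSubcategory fun X : TopCat.{u} => T0Space X

namespace Top0

instance (X : Top0.{u}) : T0Space X.obj := X.property

abbrev of (X : Type u) [TopologicalSpace X] [T0Space X] : Top0.{u} := ⟨TopCat.of X, ‹T0Space X›⟩

abbrev ofHom {X Y : Top0.{u}} (f : C(X.obj, Y.obj)) : X ⟶ Y := ObjectProperty.homMk (TopCat.ofHom f)

/-- The continuous map underlying a morphism. -/
abbrev toMap {X Y : Top0.{u}} (f : X ⟶ Y) : C(X.obj, Y.obj) := f.hom.hom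

/-- The hom-sets are ordered pointwise by the specialisation order, for which `x ≤ y` means that
every open set containing `x` contains `y`. -/
instance : OrderEnriched Top0.{u} where
  homOrder X Y :=
    { le := fun f g => ∀ x, toMap g x ⤳ toMap f x
      le_refl := fun f x => specializes_rfl
      le_trans := fun f g h hfg hgh x => (hgh x).trans (hfg x)
      le_antisymm := fun f g hfg hgf => by
        ext x
        exact ((hgf x).antisymm (hfg x)).eq }
  comp_le_comp {_ _ _ _ f' g _} hf hg :=
    fun x => (hg (toMap f' x)).trans ((hf x).map (toMap g).continuous)

/-- The Eilenberg–Moore category has the order inherited from the base category. -/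
instance (T : Monad Top0.{u}) : OrderEnriched T.Algebra where
  homOrder A B := PartialOrder.lift (fun f : A ⟶ B => f.f) (fun _ _ h => Monad.Algebra.Hom.ext h)
  comp_le_comp hf hg := OrderEnriched.comp_le_comp (C := Top0.{u}) hf hg

end Top0

/-! ### The filter monads -/

/-- The three kinds of filters of open sets: all of them, the proper ones, the prime ones. -/
inductive FilterKind
  | all
  | proper
  | prime

/-- The condition on a filter `𝔣` of open sets (`⊥ : Opens X` is the empty set). -/
def FilterKind.Admits {X : Type u} [TopologicalSpace X] :
    FilterKind → Order.PFilter (Opens X) → Prop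
  | .all, _ => True
  | .proper, 𝔣 => ⊥ ∉ 𝔣
  | .prime, 𝔣 => ⊥ ∉ 𝔣 ∧ ∀ U V : Opens X, U ⊔ V ∈ 𝔣 → U ∈ 𝔣 ∨ V ∈ 𝔣

/-- The filters of the given kind on the lattice of open sets of `X`. -/
def OpenFilter (k : FilterKind) (X : Type u) [TopologicalSpace X] : Type u :=
  {𝔣 : Order.PFilter (Opens X) // k.Admits 𝔣}

namespace OpenFilter

section

variable {k : FilterKind} {X Y : Type u} [TopologicalSpace X] [TopologicalSpace Y]

instance : Membership (Opens X) (OpenFilter k X) := ⟨fun 𝔣 U => U ∈ 𝔣.1⟩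

@[ext]
theorem ext {𝔣 𝔤 : OpenFilter k X} (h : ∀ U : Opens X, U ∈ 𝔣 ↔ U ∈ 𝔤) : 𝔣 = 𝔤 :=
  Subtype.ext (Order.PFilter.ext _ _ (Set.ext h))

theorem top_mem (𝔣 : OpenFilter k X) : ⊤ ∈ 𝔣 := Order.PFilter.top_mem (F := 𝔣.1)

theorem mem_of_le {𝔣 : OpenFilter k X} {U V : Opens X} (h : U ≤ V) (hU : U ∈ 𝔣) : V ∈ 𝔣 :=
  Order.PFilter.mem_of_le (F := 𝔣.1) h hU

theorem inf_mem {𝔣 : OpenFilter k X} {U V : Opens X} (hU : U ∈ 𝔣) (hV : V ∈ 𝔣) : U ⊓ V ∈ 𝔣 :=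
  Order.PFilter.inf_mem (F := 𝔣.1) hU hV

/-- The set `A^#` of all filters that contain the open set `A`. -/
def sharpSet (A : Opens X) : Set (OpenFilter k X) := {𝔣 | A ∈ 𝔣}

instance : TopologicalSpace (OpenFilter k X) :=
  TopologicalSpace.generateFrom (Set.range fun A : Opens X => sharpSet A)

/-- `A^#` as an open set. -/
def sharp (A : Opens X) : Opens (OpenFilter k X) :=
  ⟨sharpSet A, TopologicalSpace.isOpen_generateFrom_of_mem ⟨A, rfl⟩⟩

theorem mem_sharp {A : Opens X} {𝔣 : OpenFilter k X} : 𝔣 ∈ sharp A ↔ A ∈ 𝔣 := Iff.rfl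

instance : T0Space (OpenFilter k X) where
  t0 𝔣 𝔤 h := by
    ext U
    exact h.mem_open_iff (sharp U).isOpen

/-- A filter from its membership predicate. -/
def mk (S : Set (Opens X)) (htop : ⊤ ∈ S) (hle : ∀ {U V : Opens X}, U ≤ V → U ∈ S → V ∈ S)
    (hinf : ∀ {U V : Opens X}, U ∈ S → V ∈ S → U ⊓ V ∈ S)
    (hbot : k ≠ .all → ⊥ ∉ S)
    (hsup : k = .prime → ∀ U V : Opens X, U ⊔ V ∈ S → U ∈ S ∨ V ∈ S) : OpenFilter k X :=
  ⟨(Order.IsPFilter.of_def ⟨⊤, htop⟩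
      (fun U hU V hV => ⟨U ⊓ V, hinf hU hV, inf_le_left, inf_le_right⟩) hle).toPFilter, by
    cases k with
    | all => trivial
    | proper => exact hbot (by simp)
    | prime => exact ⟨hbot (by simp), hsup rfl⟩⟩

theorem mem_mk {S : Set (Opens X)} {h₁ h₂ h₃ h₄ h₅} {U : Opens X} :
    U ∈ (mk S h₁ h₂ h₃ h₄ h₅ : OpenFilter k X) ↔ U ∈ S := Iff.rfl

theorem bot_notMem (hk : k ≠ .all) (𝔣 : OpenFilter k X) : ⊥ ∉ 𝔣 := by
  cases k with
  | all => exact absurd rfl hk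
  | proper => exact 𝔣.2
  | prime => exact 𝔣.2.1

theorem mem_or_mem (hk : k = .prime) (𝔣 : OpenFilter k X) (U V : Opens X) (h : U ⊔ V ∈ 𝔣) :
    U ∈ 𝔣 ∨ V ∈ 𝔣 := by
  subst hk
  exact 𝔣.2.2 U V h

/-- The action on continuous maps: `B` belongs to the image of `𝔣` iff `f⁻¹(B) ∈ 𝔣`. -/
def map (f : C(X, Y)) (𝔣 : OpenFilter k X) : OpenFilter k Y :=
  mk {B | Opens.comap f B ∈ 𝔣} 𝔣.top_mem (fun h hU => mem_of_le (fun _ hx => h hx) hU)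
    (fun hU hV => inf_mem hU hV) (fun hk h => 𝔣.bot_notMem hk h)
    (fun hk _ _ h => 𝔣.mem_or_mem hk _ _ h)

theorem mem_map {f : C(X, Y)} {𝔣 : OpenFilter k X} {B : Opens Y} :
    B ∈ map f 𝔣 ↔ Opens.comap f B ∈ 𝔣 := Iff.rfl

/-- The filter of open neighbourhoods of a point. -/
def unit (x : X) : OpenFilter k X :=
  mk {U | x ∈ U} trivial (fun h hU => h hU) (fun hU hV => ⟨hU, hV⟩) (fun _ h => h)
    (fun _ _ _ h => h)

theorem mem_unit {x : X} {U : Opens X} : U ∈ (unit x : OpenFilter k X) ↔ x ∈ U := Iff.rfl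

/-- The multiplication: `A` belongs to the image of `𝔉` iff `A^# ∈ 𝔉`. -/
def mult (𝔉 : OpenFilter k (OpenFilter k X)) : OpenFilter k X :=
  mk {A | sharp A ∈ 𝔉}
    (mem_of_le (fun 𝔣 _ => 𝔣.top_mem) 𝔉.top_mem)
    (fun h hU => mem_of_le (fun _ h𝔣 => mem_of_le h h𝔣) hU)
    (fun {U V} hU hV => mem_of_le (U := sharp U ⊓ sharp V)
      (fun 𝔣 (h𝔣 : U ∈ 𝔣 ∧ V ∈ 𝔣) => inf_mem h𝔣.1 h𝔣.2) (inf_mem hU hV))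
    (fun hk h => 𝔉.bot_notMem hk (mem_of_le (fun 𝔣 h𝔣 => 𝔣.bot_notMem hk h𝔣) h))
    (fun hk _ _ h => 𝔉.mem_or_mem hk _ _ (mem_of_le (fun 𝔣 h𝔣 => 𝔣.mem_or_mem hk _ _ h𝔣) h))

theorem mem_mult {𝔉 : OpenFilter k (OpenFilter k X)} {A : Opens X} :
    A ∈ mult 𝔉 ↔ sharp A ∈ 𝔉 := Iff.rfl

theorem continuous_of_preimage_sharp {f : Y → OpenFilter k X}
    (h : ∀ A : Opens X, IsOpen {y | A ∈ f y}) : Continuous f :=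
  continuous_generateFrom_iff.2 (by rintro _ ⟨A, rfl⟩; exact h A)

/-- The sets `A^#` form a base. -/
theorem exists_sharp_subset {V : Set (OpenFilter k X)} (hV : IsOpen V) {𝔣 : OpenFilter k X}
    (h𝔣 : 𝔣 ∈ V) : ∃ A : Opens X, A ∈ 𝔣 ∧ ∀ 𝔤 : OpenFilter k X, A ∈ 𝔤 → 𝔤 ∈ V := by
  induction hV with
  | basic s hs =>
    obtain ⟨A, rfl⟩ := hs
    exact ⟨A, h𝔣, fun _ h => h⟩
  | univ => exact ⟨⊤, 𝔣.top_mem, fun _ _ => trivial⟩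
  | inter s t _ _ ihs iht =>
    obtain ⟨A, hA, hA'⟩ := ihs h𝔣.1
    obtain ⟨B, hB, hB'⟩ := iht h𝔣.2
    exact ⟨A ⊓ B, inf_mem hA hB, fun 𝔤 h =>
      ⟨hA' 𝔤 (mem_of_le inf_le_left h), hB' 𝔤 (mem_of_le inf_le_right h)⟩⟩
  | sUnion S _ ih =>
    obtain ⟨s, hs, hs'⟩ := h𝔣
    obtain ⟨A, hA, hA'⟩ := ih s hs hs'
    exact ⟨A, hA, fun 𝔤 h => ⟨s, hs, hA' 𝔤 h⟩⟩

/-- A continuous retraction of the unit sends `𝔣` to a convergence point of `𝔣`. -/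
theorem mem_of_retraction (a : C(OpenFilter k X, X)) (ha : ∀ x, a (unit x) = x)
    {𝔣 : OpenFilter k X} {U : Opens X} (hU : a 𝔣 ∈ U) : U ∈ 𝔣 := by
  obtain ⟨V, hV, hVU⟩ := exists_sharp_subset (U.isOpen.preimage a.continuous) hU
  refine mem_of_le (fun x hx => ?_) hV
  have h : a (unit x) ∈ U := hVU (unit x) hx
  rwa [ha] at h

theorem retraction_specializes (a b : C(OpenFilter k X, X)) (ha : ∀ x, a (unit x) = x)
    (hb : ∀ x, b (unit x) = x) (𝔣 : OpenFilter k X) : b 𝔣 ⤳ a 𝔣 := by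
  have h : 𝔣 ⤳ unit (a 𝔣) := by
    rw [specializes_iff_forall_open]
    intro V hV hx
    obtain ⟨W, hW, hWV⟩ := exists_sharp_subset hV hx
    exact hWV _ (mem_of_retraction a ha hW)
  simpa only [hb] using h.map b.continuous

theorem retraction_unique [T0Space X] (a b : C(OpenFilter k X, X)) (ha : ∀ x, a (unit x) = x)
    (hb : ∀ x, b (unit x) = x) : a = b :=
  ContinuousMap.ext fun 𝔣 => ((retraction_specializes b a hb ha 𝔣).antisymm
    (retraction_specializes a b ha hb 𝔣)).eq

end

end OpenFilter

/-- The filter monad (`k = all`), the proper filter monad (`k = proper`) and the prime filter monad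
(`k = prime`) on `T₀` spaces. -/
def filterMonad (k : FilterKind) : Monad Top0.{u} where
  obj X := Top0.of (OpenFilter k X.obj)
  map f := Top0.ofHom ⟨OpenFilter.map (Top0.toMap f),
    OpenFilter.continuous_of_preimage_sharp fun A =>
      (OpenFilter.sharp (Opens.comap (Top0.toMap f) A)).isOpen⟩
  map_id _ := by ext; rfl
  map_comp _ _ := by ext; rfl
  η :=
    { app X := Top0.ofHom ⟨OpenFilter.unit,
        OpenFilter.continuous_of_preimage_sharp fun A => A.isOpen⟩
      naturality _ _ _ := by ext; rfl }
  μ :=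
    { app X := Top0.ofHom ⟨OpenFilter.mult,
        OpenFilter.continuous_of_preimage_sharp fun A =>
          (OpenFilter.sharp (OpenFilter.sharp A)).isOpen⟩
      naturality _ _ _ := by ext; rfl }
  assoc _ := by ext; rfl
  left_unit _ := by ext; rfl
  right_unit _ := by ext; rfl

/-- An algebra structure on a space is unique: it sends a filter to its largest convergence point.
So the Eilenberg–Moore category can be regarded as a subcategory of the base category. -/
theorem filterMonad_forget_obj_injective (k : FilterKind) :
    Function.Injective (filterMonad.{u} k).forget.obj := by
  rintro ⟨X, a, ha, ha'⟩ ⟨Y, b, hb, hb'⟩ hXY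
  obtain rfl : X = Y := hXY
  have h : a = b := ObjectProperty.hom_ext _ (TopCat.hom_ext (OpenFilter.retraction_unique
    (Top0.toMap a) (Top0.toMap b)
    (fun x => congrArg (fun f : X ⟶ X => Top0.toMap f x) ha)
    (fun x => congrArg (fun f : X ⟶ X => Top0.toMap f x) hb)))
  subst h
  rfl

/-! ### The algebras cogenerated by the Sierpiński space -/

/-- The Sierpiński space (the open sets of `Prop` are `∅`, `{True}` and the whole space). -/
abbrev sierpinski : Top0.{u} := Top0.of (ULift.{u} Prop)

/-- The open point of the Sierpiński space, as an open set. -/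
def sierpinskiOpen : Opens (ULift.{u} Prop) :=
  ⟨{p | p.down}, by
    convert isOpen_singleton_true.preimage continuous_uliftDown using 1
    ext p
    simp⟩

/-- The Sierpiński space as an algebra: a filter is sent to its largest convergence point, which is
the open point iff the filter contains the open set formed by that point. -/
def sierpinskiAlgebra (k : FilterKind) : (filterMonad.{u} k).Algebra where
  A := sierpinski
  a := Top0.ofHom ⟨fun 𝔣 : OpenFilter k (ULift.{u} Prop) => ULift.up (sierpinskiOpen ∈ 𝔣),
    continuous_uliftUp.comp
      (continuous_Prop.2 (OpenFilter.sharp (k := k) sierpinskiOpen).isOpen)⟩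
  unit := by ext; rfl
  assoc := by ext; rfl

/-- The algebra `X` is a member of `X_alg`: the diagram
`X ⟶ X̂ ⇉ ⋔(Hom(X̂, S), S)`, with `X̂ = ⋔(Hom(X, S), S)` and all hom-posets and cotensor products
formed in the category of algebras, is an equaliser diagram of `T₀` spaces. Here `n` and `α` are the
canonical morphisms, with components `f : X ⟶ S` and `g : X̂ ⟶ S`, and the component of `β` at
`g : X̂ ⟶ S` is the projection of `X̂` at `n ≫ g`. -/
def IsSierpinskiCogenerated {k : FilterKind} (X : (filterMonad.{u} k).Algebra) : Prop :=
  ∃ (X₁ X₂ : (filterMonad.{u} k).Algebra)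
    (π₁ : (X ⟶ sierpinskiAlgebra k) → (X₁ ⟶ sierpinskiAlgebra k))
    (π₂ : (X₁ ⟶ sierpinskiAlgebra k) → (X₂ ⟶ sierpinskiAlgebra k))
    (n : X ⟶ X₁) (α β : X₁ ⟶ X₂),
    IsCotensor (X ⟶ sierpinskiAlgebra k) (sierpinskiAlgebra k) X₁ π₁ ∧
    IsCotensor (X₁ ⟶ sierpinskiAlgebra k) (sierpinskiAlgebra k) X₂ π₂ ∧
    (∀ f, n ≫ π₁ f = f) ∧ (∀ g, α ≫ π₂ g = g) ∧ (∀ g, β ≫ π₂ g = π₁ (n ≫ g)) ∧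
    ∃ e : n.f ≫ α.f = n.f ≫ β.f, Nonempty (Limits.IsLimit (Limits.Fork.ofι n.f e))

/-- The full subcategory `X_alg` of the category of algebras. -/
def xAlg (k : FilterKind) : Subcategory (filterMonad.{u} k).Algebra :=
  Subcategory.full IsSierpinskiCogenerated

/-- `X_alg` as a subcategory of the category of `T₀` spaces. -/
def xAlgTop (k : FilterKind) : Subcategory Top0.{u} :=
  (xAlg k).image (filterMonad k).forget (filterMonad_forget_obj_injective k)

/-! ### Algebraic lattices, bounded complete algebraic domains, spectral spaces -/

/-- Algebraic domains: directed suprema exist, and every element is the directed supremum of the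
compact elements below it. -/
structure IsAlgebraicDomain (P : Type u) [PartialOrder P] : Prop where
  exists_isLUB : ∀ D : Set P, D.Nonempty → DirectedOn (· ≤ ·) D → ∃ a, IsLUB D a
  nonempty_compact : ∀ x : P, {y : P | y ≤ x ∧ IsCompactElement y}.Nonempty
  directed_compact : ∀ x : P, DirectedOn (· ≤ ·) {y : P | y ≤ x ∧ IsCompactElement y}
  isLUB_compact : ∀ x : P, IsLUB {y : P | y ≤ x ∧ IsCompactElement y} x

/-- Algebraic lattices: algebraic domains that are complete lattices. -/
structure IsAlgebraicLattice (P : Type u) [PartialOrder P] : Prop extends IsAlgebraicDomain P where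
  exists_isLUB_all : ∀ s : Set P, ∃ a, IsLUB s a
  exists_isGLB_all : ∀ s : Set P, ∃ a, IsGLB s a

/-- Bounded complete algebraic domains (the empty poset is one). -/
structure IsBoundedCompleteAlgebraicDomain (P : Type u) [PartialOrder P] : Prop
    extends IsAlgebraicDomain P where
  exists_isLUB_of_bddAbove : ∀ s : Set P, BddAbove s → ∃ a, IsLUB s a

/-- The topology of `X` is the Scott topology of the specialisation order of `X`. -/
def Top0.IsScottSpace (X : Top0.{u}) : Prop :=
  @Topology.IsScott X.obj Set.univ (specializationPreorder X.obj) _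

/-- A continuous map, as a monotone map for the specialisation orders. -/
abbrev Top0.specMap {X Y : Top0.{u}} (f : X ⟶ Y) :
    Specialization X.obj →o Specialization Y.obj := Specialization.map (Top0.toMap f)

/-- The category of algebraic lattices, with maps that preserve directed suprema and all infima, as
a subcategory of the category of `T₀` spaces through the Scott topology. -/
def algLat : Subcategory Top0.{u} where
  obj := fun X => X.IsScottSpace ∧ IsAlgebraicLattice (Specialization X.obj)
  hom := fun X Y f =>
    (X.IsScottSpace ∧ IsAlgebraicLattice (Specialization X.obj)) ∧
    (Y.IsScottSpace ∧ IsAlgebraicLattice (Specialization Y.obj)) ∧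
    ScottContinuous (Top0.specMap f) ∧
    ∀ (s : Set (Specialization X.obj)) (a : Specialization X.obj),
      IsGLB s a → IsGLB (Top0.specMap f '' s) (Top0.specMap f a)
  source_mem _ h := h.1
  target_mem _ h := h.2.1
  id_mem X h := ⟨h, h, ScottContinuous.id, fun s a hs => by
    rw [show (Top0.specMap (𝟙 X) : _ → _) = id from rfl]; simpa using hs⟩
  comp_mem f g hf hg := ⟨hf.1, hg.2.1, ScottContinuous.comp (g := Top0.specMap g)
    hf.2.2.1 hg.2.2.1, fun s a hs => by
    have := hg.2.2.2 _ _ (hf.2.2.2 s a hs)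
    rwa [Set.image_image] at this⟩

/-- The category of bounded complete algebraic domains, with maps that preserve directed suprema and
all non-empty infima, as a subcategory of the category of `T₀` spaces through the Scott topology. -/
def algDom : Subcategory Top0.{u} where
  obj := fun X => X.IsScottSpace ∧ IsBoundedCompleteAlgebraicDomain (Specialization X.obj)
  hom := fun X Y f =>
    (X.IsScottSpace ∧ IsBoundedCompleteAlgebraicDomain (Specialization X.obj)) ∧
    (Y.IsScottSpace ∧ IsBoundedCompleteAlgebraicDomain (Specialization Y.obj)) ∧
    ScottContinuous (Top0.specMap f) ∧
    ∀ (s : Set (Specialization X.obj)) (a : Specialization X.obj), s.Nonempty →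
      IsGLB s a → IsGLB (Top0.specMap f '' s) (Top0.specMap f a)
  source_mem _ h := h.1
  target_mem _ h := h.2.1
  id_mem X h := ⟨h, h, ScottContinuous.id, fun s a _ hs => by
    rw [show (Top0.specMap (𝟙 X) : _ → _) = id from rfl]; simpa using hs⟩
  comp_mem f g hf hg := ⟨hf.1, hg.2.1, ScottContinuous.comp (g := Top0.specMap g)
    hf.2.2.1 hg.2.2.1, fun s a hne hs => by
    have := hg.2.2.2 _ _ (hne.image _) (hf.2.2.2 s a hne hs)
    rwa [Set.image_image] at this⟩

/-- The category of spectral spaces and spectral maps. -/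
def spec : Subcategory Top0.{u} where
  obj := fun X => SpectralSpace X.obj
  hom := fun X Y f => SpectralSpace X.obj ∧ SpectralSpace Y.obj ∧ IsSpectralMap (Top0.toMap f)
  source_mem _ h := h.1
  target_mem _ h := h.2.1
  id_mem _ h := ⟨h, h, isSpectralMap_id⟩
  comp_mem _ _ hf hg := ⟨hf.1, hg.2.1, hg.2.2.comp hf.2.2⟩

open scoped Topology

/-! ### Filters defined by subsets; monotonicity of the monads. -/

namespace OpenFilter

variable {k : FilterKind} {X : Type u} [TopologicalSpace X]

/-- The open sets containing a given set form a filter. -/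
def principal (t : Set X) (hk : k ≠ .prime) (ht : k ≠ .all → t.Nonempty) : OpenFilter k X :=
  mk {V | t ⊆ V} (fun _ _ => trivial) (fun h hU _ hx => h (hU hx))
    (fun hU hV => Set.subset_inter hU hV)
    (fun h h' => by obtain ⟨x, hx⟩ := ht h; exact h' hx) (fun h => absurd h hk)

theorem mem_principal {t : Set X} {hk : k ≠ .prime} {ht : k ≠ .all → t.Nonempty} {V : Opens X} :
    V ∈ principal t hk ht ↔ t ⊆ V := Iff.rfl

/-- The open sets meeting a given nonempty set form a filter, provided that the intersection of two
of them meets the set again. -/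
def meeting (t : Set X) (ht : t.Nonempty)
    (h : ∀ U V : Opens X, (t ∩ U).Nonempty → (t ∩ V).Nonempty → (t ∩ (U ∩ V)).Nonempty) :
    OpenFilter k X :=
  mk {V | (t ∩ V).Nonempty} (by simpa using ht) (fun h hU => hU.mono (Set.inter_subset_inter_right _ h))
    (fun {U V} hU hV => by simpa using h U V hU hV)
    (fun _ h' => by simp at h')
    (fun _ U V h' => by
      obtain ⟨x, hx, hU | hV⟩ := h'
      exacts [Or.inl ⟨x, hx, hU⟩, Or.inr ⟨x, hx, hV⟩])

theorem mem_meeting {t : Set X} {ht : t.Nonempty}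
    {h : ∀ U V : Opens X, (t ∩ U).Nonempty → (t ∩ V).Nonempty → (t ∩ (U ∩ V)).Nonempty}
    {V : Opens X} : V ∈ (meeting t ht h : OpenFilter k X) ↔ (t ∩ V).Nonempty := Iff.rfl

end OpenFilter

theorem Top0.hom_ext {X Y : Top0.{u}} {f g : X ⟶ Y} (h : ∀ x, toMap f x = toMap g x) : f = g :=
  ObjectProperty.hom_ext _ (TopCat.hom_ext (ContinuousMap.ext h))

/-- This makes the monads order-enriched, so that extension to free algebras is monotone. Preimages
of open sets grow with the map. -/
theorem Top0.filterMonad_map_mono {k : FilterKind} {X Y : Top0.{u}} {f g : X ⟶ Y} (h : f ≤ g) :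
    (filterMonad k).map f ≤ (filterMonad k).map g := by
  intro 𝔣
  rw [specializes_iff_forall_open]
  intro V hV hx
  obtain ⟨A, hA, hA'⟩ := OpenFilter.exists_sharp_subset hV hx
  have hle : Opens.comap (toMap f) A ≤ Opens.comap (toMap g) A :=
    fun x hx => (show toMap g x ⤳ toMap f x from h x).mem_open A.isOpen hx
  exact hA' _ (OpenFilter.mem_of_le (𝔣 := 𝔣) hle hA)

/-! ### Clear open sets and homomorphisms. -/

/-- The algebras for one of the filter monads. -/
abbrev FilterAlgebra (k : FilterKind) : Type (u + 1) := (filterMonad.{u} k).Algebra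

namespace FilterAlgebra

variable {k : FilterKind}

section Clear

variable (X : FilterAlgebra.{u} k)

/-- The largest convergence point of a filter. -/
def lim (𝔣 : OpenFilter k X.A.obj) : X.A.obj := Top0.toMap X.a 𝔣

theorem lim_unit (x : X.A.obj) : X.lim (OpenFilter.unit x) = x :=
  congrArg (fun f : X.A ⟶ X.A => Top0.toMap f x) X.unit

variable {X} in
theorem mem_of_lim_mem {𝔣 : OpenFilter k X.A.obj} {U : Opens X.A.obj} (h : X.lim 𝔣 ∈ U) : U ∈ 𝔣 :=
  OpenFilter.mem_of_retraction (Top0.toMap X.a) X.lim_unit h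

/-- An open set is clear if it contains the largest convergence points of all filters to which it
belongs; these are the open sets whose characteristic map is a homomorphism. -/
def IsClear (U : Opens X.A.obj) : Prop := ∀ 𝔣 : OpenFilter k X.A.obj, U ∈ 𝔣 → X.lim 𝔣 ∈ U

/-- The clear open sets form a base. -/
def HasClearBasis : Prop :=
  ∀ (x : X.A.obj) (V : Opens X.A.obj), x ∈ V → ∃ U : Opens X.A.obj, X.IsClear U ∧ x ∈ U ∧ U ≤ V

variable {X}

theorem IsClear.lim_mem_iff {U : Opens X.A.obj} (h : X.IsClear U) {𝔣 : OpenFilter k X.A.obj} :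
    X.lim 𝔣 ∈ U ↔ U ∈ 𝔣 := ⟨mem_of_lim_mem, h 𝔣⟩

theorem isClear_top : X.IsClear ⊤ := fun _ _ => trivial

theorem IsClear.inf {U V : Opens X.A.obj} (hU : X.IsClear U) (hV : X.IsClear V) :
    X.IsClear (U ⊓ V) := fun 𝔣 h =>
  ⟨hU 𝔣 (OpenFilter.mem_of_le inf_le_left h), hV 𝔣 (OpenFilter.mem_of_le inf_le_right h)⟩

theorem isClear_bot (hk : k ≠ .all) : X.IsClear ⊥ := fun 𝔣 h => absurd h (𝔣.bot_notMem hk)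

theorem IsClear.sup (hk : k = .prime) {U V : Opens X.A.obj} (hU : X.IsClear U)
    (hV : X.IsClear V) : X.IsClear (U ⊔ V) := fun 𝔣 h =>
  (𝔣.mem_or_mem hk U V h).imp (hU 𝔣) (hV 𝔣)

/-- Finite intersections of clear open sets are clear, so a subbase is enough. -/
theorem hasClearBasis_of_eq_generateFrom {S : Set (Set X.A.obj)}
    (hS : X.A.obj.str = generateFrom S)
    (h : ∀ s ∈ S, ∀ x ∈ s, ∃ U : Opens X.A.obj, X.IsClear U ∧ x ∈ U ∧ (U : Set X.A.obj) ⊆ s) :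
    X.HasClearBasis := by
  rintro x ⟨V, hV⟩ hx
  have hV' : GenerateOpen S V := by
    have h : IsOpen[X.A.obj.str] V := hV
    rwa [hS] at h
  change x ∈ V at hx
  change ∃ U : Opens X.A.obj, X.IsClear U ∧ x ∈ U ∧ (U : Set X.A.obj) ⊆ V
  clear hV
  induction hV' with
  | basic s hs =>
    exact h s hs x hx
  | univ => exact ⟨⊤, isClear_top, trivial, le_rfl⟩
  | inter s t hs ht ihs iht =>
    obtain ⟨U, hU, hxU, hUs⟩ := ihs hx.1
    obtain ⟨V, hV, hxV, hVt⟩ := iht hx.2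
    exact ⟨U ⊓ V, hU.inf hV, ⟨hxU, hxV⟩, fun y hy => ⟨hUs hy.1, hVt hy.2⟩⟩
  | sUnion T hT ih =>
    obtain ⟨s, hs, hxs⟩ := hx
    obtain ⟨U, hU, hxU, hUs⟩ := ih s hs hxs
    exact ⟨U, hU, hxU, fun y hy => ⟨s, hs, hUs hy⟩⟩

theorem HasClearBasis.specializes_iff (hX : X.HasClearBasis) {x y : X.A.obj} :
    x ⤳ y ↔ ∀ U, X.IsClear U → y ∈ U → x ∈ U := by
  refine ⟨fun h U _ hy => h.mem_open U.isOpen hy, fun h => ?_⟩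
  rw [specializes_iff_forall_open]
  intro V hV hy
  obtain ⟨U, hU, hyU, hUV⟩ := hX y ⟨V, hV⟩ hy
  exact hUV (h U hU hyU)

theorem HasClearBasis.ext (hX : X.HasClearBasis) {x y : X.A.obj}
    (h : ∀ U, X.IsClear U → (x ∈ U ↔ y ∈ U)) : x = y :=
  ((hX.specializes_iff.2 fun U hU => (h U hU).2).antisymm
    (hX.specializes_iff.2 fun U hU => (h U hU).1)).eq

theorem HasClearBasis.continuous (hX : X.HasClearBasis) {Y : Type*} [TopologicalSpace Y]
    {f : Y → X.A.obj} (h : ∀ U : Opens X.A.obj, X.IsClear U → IsOpen {y | f y ∈ U}) :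
    Continuous f := by
  rw [continuous_def]
  intro V hV
  rw [isOpen_iff_forall_mem_open]
  intro y hy
  obtain ⟨U, hU, hyU, hUV⟩ := hX (f y) ⟨V, hV⟩ hy
  exact ⟨_, fun z hz => hUV hz, h U hU, hyU⟩

/-- The open members of an ultrafilter form a prime filter, which is admitted by all three kinds;
the ultrafilter converges to the limit of that filter. -/
theorem IsClear.isCompact {U : Opens X.A.obj} (hU : X.IsClear U) :
    IsCompact (U : Set X.A.obj) := by
  rw [isCompact_iff_ultrafilter_le_nhds]
  intro 𝔲 h𝔲
  let 𝔣 : OpenFilter k X.A.obj := .mk {V | (V : Set X.A.obj) ∈ 𝔲} Filter.univ_mem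
    (fun h hV => Filter.mem_of_superset hV h) (fun hV hW => Filter.inter_mem hV hW)
    (fun _ h => 𝔲.empty_notMem h) (fun _ V W h => Ultrafilter.union_mem_iff.1 h)
  refine ⟨X.lim 𝔣, hU 𝔣 (Filter.le_principal_iff.1 h𝔲), fun s hs => ?_⟩
  obtain ⟨V, hVs, hV, hx⟩ := mem_nhds_iff.1 hs
  exact Filter.mem_of_superset (mem_of_lim_mem (U := ⟨V, hV⟩) hx : (⟨V, hV⟩ : Opens _) ∈ 𝔣) hVs

/-- A filter of clear open sets which is proper, respectively prime, as required by the kind, is the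
trace of a neighbourhood filter. -/
theorem exists_point (φ : Opens X.A.obj → Prop)
    (hmono : ∀ U V, X.IsClear U → X.IsClear V → U ≤ V → φ U → φ V)
    (htop : φ ⊤) (hinf : ∀ U V, X.IsClear U → X.IsClear V → φ U → φ V → φ (U ⊓ V))
    (hbot : k ≠ .all → ¬ φ ⊥)
    (hsup : k = .prime → ∀ U V, X.IsClear U → X.IsClear V → φ (U ⊔ V) → φ U ∨ φ V)
    (hprime : k = .prime → X.HasClearBasis) :
    ∃ x, ∀ U, X.IsClear U → (x ∈ U ↔ φ U) := by
  by_cases hk : k = .prime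
  -- The filter of open sets generated by `φ` need not be prime. The open sets meeting `t` are
  -- automatically prime, and their clear members turn out to be those satisfying `φ`.
  · let t : Set X.A.obj := {z | ∀ V, X.IsClear V → z ∈ V → φ V}
    have ht : ∀ W, X.IsClear W → φ W → (t ∩ W).Nonempty := by
      intro W hW hφW
      by_contra hne
      -- If `W` misses `t`, each of its points has a clear neighbourhood violating `φ`. By
      -- compactness of `W` and primality of `φ`, a single clear set violating `φ` covers `W`.
      obtain ⟨V, hV, hφV, hWV⟩ := (hW.isCompact).induction_on
        (p := fun s => ∃ V, X.IsClear V ∧ ¬ φ V ∧ s ⊆ V)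
        ⟨⊥, isClear_bot (by simp [hk]), hbot (by simp [hk]), Set.empty_subset _⟩
        (fun s s' hs ⟨V, hV, hφV, hV'⟩ => ⟨V, hV, hφV, hs.trans hV'⟩)
        (fun s s' ⟨V, hV, hφV, hV'⟩ ⟨V₂, hV₂, hφV₂, hV₂'⟩ => ⟨V ⊔ V₂, hV.sup hk hV₂,
          fun h => (hsup hk V V₂ hV hV₂ h).elim hφV hφV₂, Set.union_subset_union hV' hV₂'⟩)
        (fun x hx => by
          have hxt : x ∉ t := fun hxt => hne ⟨x, hxt, hx⟩
          obtain ⟨V, hV, hxV, hφV⟩ : ∃ V, X.IsClear V ∧ x ∈ V ∧ ¬ φ V := by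
            simpa [t] using hxt
          exact ⟨V, mem_nhdsWithin_of_mem_nhds (V.isOpen.mem_nhds hxV), V, hV, hφV, subset_rfl⟩)
      exact hφV (hmono W V hW hV hWV hφW)
    have hmeet : ∀ V : Opens X.A.obj, (t ∩ V).Nonempty → ∃ U, X.IsClear U ∧ U ≤ V ∧ φ U := by
      rintro V ⟨z, hz, hzV⟩
      obtain ⟨U, hU, hzU, hUV⟩ := hprime hk z V hzV
      exact ⟨U, hU, hUV, hz U hU hzU⟩
    refine ⟨X.lim (.meeting t (by simpa using ht ⊤ isClear_top htop) fun U V hU hV => ?_),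
      fun U hU => hU.lim_mem_iff.trans ⟨fun h => ?_, ht U hU⟩⟩
    · obtain ⟨U', hU', hUU, hφU⟩ := hmeet U hU
      obtain ⟨V', hV', hVV, hφV⟩ := hmeet V hV
      exact (ht _ (hU'.inf hV') (hinf U' V' hU' hV' hφU hφV)).mono
        (Set.inter_subset_inter_right _ (Set.inter_subset_inter hUU hVV))
    · obtain ⟨U', hU', hUU, hφU⟩ := hmeet U h
      exact hmono U' U hU' hU hUU hφU
  -- Without primality the filter generated by `φ` serves.
  · refine ⟨X.lim (.mk {V | ∃ U, X.IsClear U ∧ U ≤ V ∧ φ U} ⟨⊤, isClear_top, le_rfl, htop⟩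
      (fun h ⟨U, hU, hUV, hφ⟩ => ⟨U, hU, hUV.trans h, hφ⟩)
      (fun ⟨U, hU, hUV, hφ⟩ ⟨U', hU', hUV', hφ'⟩ =>
        ⟨U ⊓ U', hU.inf hU', inf_le_inf hUV hUV', hinf U U' hU hU' hφ hφ'⟩)
      (fun hk ⟨U, _, hU', hφ⟩ => hbot hk (le_bot_iff.1 hU' ▸ hφ))
      (fun h => absurd h hk)), fun U hU => hU.lim_mem_iff.trans ⟨?_, fun h => ⟨U, hU, le_rfl, h⟩⟩⟩
    rintro ⟨U', hU', hUU, hφ⟩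
    exact hmono U' U hU' hU hUU hφ

end Clear

section Hom

variable {X Y : FilterAlgebra.{u} k}

theorem hom_lim (f : X ⟶ Y) (𝔣 : OpenFilter k X.A.obj) :
    Top0.toMap f.f (X.lim 𝔣) = Y.lim (OpenFilter.map (Top0.toMap f.f) 𝔣) :=
  congrArg (fun g : (filterMonad k).obj X.A ⟶ Y.A => Top0.toMap g 𝔣) f.h.symm

theorem IsClear.comap (f : X ⟶ Y) {U : Opens Y.A.obj} (hU : Y.IsClear U) :
    X.IsClear (Opens.comap (Top0.toMap f.f) U) := fun 𝔣 h => by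
  change Top0.toMap f.f (X.lim 𝔣) ∈ U
  rw [hom_lim]
  exact hU _ h

/-- A continuous map is a homomorphism if the preimages of enough clear open sets to separate the
points are clear. -/
def homMk {ι : Type*} {B : ι → Opens Y.A.obj} (hB : ∀ i, Y.IsClear (B i))
    (hsep : ∀ x y : Y.A.obj, (∀ i, x ∈ B i ↔ y ∈ B i) → x = y) (f : X.A ⟶ Y.A)
    (h : ∀ i, X.IsClear (Opens.comap (Top0.toMap f) (B i))) : X ⟶ Y where
  f := f
  h := Top0.hom_ext fun 𝔣 => hsep _ _ fun i => by
    change Y.lim (OpenFilter.map (Top0.toMap f) 𝔣) ∈ B i ↔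
      X.lim 𝔣 ∈ Opens.comap (Top0.toMap f) (B i)
    exact (hB i).lim_mem_iff.trans (h i).lim_mem_iff.symm

/-- A continuous map under which the preimages of clear open sets are clear is a homomorphism. -/
def HasClearBasis.homMk (hY : Y.HasClearBasis) (f : X.A ⟶ Y.A)
    (h : ∀ U, Y.IsClear U → X.IsClear (Opens.comap (Top0.toMap f) U)) : X ⟶ Y :=
  FilterAlgebra.homMk (B := fun U : {U : Opens Y.A.obj // Y.IsClear U} => U.1) (fun U => U.2)
    (fun _ _ h => hY.ext fun U hU => h ⟨U, hU⟩) f fun U => h U.1 U.2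

theorem homExt {f g : X ⟶ Y} (h : ∀ x, Top0.toMap f.f x = Top0.toMap g.f x) : f = g :=
  Monad.Algebra.Hom.ext (Top0.hom_ext h)

end Hom

/-! ### Algebra structures determined by a subbase. -/

section OfSubbasis

variable (X : Top0.{u}) {ι : Type*} (B : ι → Opens X.obj)

theorem specializes_of_subbasis
    (hB : X.obj.str = generateFrom (Set.range fun i => (B i : Set X.obj)))
    {x y : X.obj} (h : ∀ i, y ∈ B i → x ∈ B i) : x ⤳ y := by
  rw [specializes_iff_forall_open]
  intro s hs
  have hs' : GenerateOpen (Set.range fun i => (B i : Set X.obj)) s := by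
    have h : IsOpen[X.obj.str] s := hs
    rwa [hB] at h
  clear hs
  induction hs' with
  | basic s hs => obtain ⟨i, rfl⟩ := hs; exact h i
  | univ => simp
  | inter s t _ _ hs ht => exact And.imp hs ht
  | sUnion S _ ih => exact fun ⟨t, ht, hyt⟩ => ⟨t, ht, ih t ht hyt⟩

theorem ext_of_subbasis (hB : X.obj.str = generateFrom (Set.range fun i => (B i : Set X.obj)))
    {x y : X.obj} (h : ∀ i, x ∈ B i ↔ y ∈ B i) : x = y :=
  ((specializes_of_subbasis X B hB fun i => (h i).2).antisymm
    (specializes_of_subbasis X B hB fun i => (h i).1)).eq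

theorem continuous_of_subbasis
    (hB : X.obj.str = generateFrom (Set.range fun i => (B i : Set X.obj)))
    (l : OpenFilter k X.obj → X.obj) (hl : ∀ 𝔣 i, l 𝔣 ∈ B i ↔ B i ∈ 𝔣) : Continuous l := by
  have hc : ∀ i, IsOpen (l ⁻¹' B i) := fun i => by
    convert (OpenFilter.sharp (k := k) (B i)).isOpen using 1
    ext 𝔣
    exact hl 𝔣 i
  have hc' := continuous_generateFrom_iff.2
    (Set.forall_mem_range (p := fun s : Set X.obj => IsOpen (l ⁻¹' s)).2 hc)
  rwa [← hB] at hc'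

variable (hB : X.obj.str = generateFrom (Set.range fun i => (B i : Set X.obj)))
  (l : OpenFilter k X.obj → X.obj) (hl : ∀ 𝔣 i, l 𝔣 ∈ B i ↔ B i ∈ 𝔣)

/-- The algebra structure given by a choice of points to which filters converge, provided that
membership of the chosen points in the sets of a subbase is membership of these in the filters. -/
def ofSubbasis : FilterAlgebra.{u} k where
  A := X
  a := Top0.ofHom ⟨l, continuous_of_subbasis X B hB l hl⟩
  unit := Top0.hom_ext fun x => ext_of_subbasis X B hB fun i => hl (OpenFilter.unit x) i
  assoc := Top0.hom_ext fun 𝔉 => ext_of_subbasis X B hB fun i => by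
    let lc : C(OpenFilter k X.obj, X.obj) := ⟨l, continuous_of_subbasis X B hB l hl⟩
    have : OpenFilter.sharp (B i) = Opens.comap lc (B i) := by
      ext 𝔣
      exact (hl 𝔣 i).symm
    exact (hl (OpenFilter.mult 𝔉) i).trans ((iff_of_eq (congrArg
      (fun U => U ∈ (show OpenFilter k (OpenFilter k X.obj) from 𝔉)) this)).trans
      (hl (OpenFilter.map lc 𝔉) i).symm)

theorem ofSubbasis_isClear (i : ι) : (ofSubbasis X B hB l hl).IsClear (B i) :=
  fun 𝔣 h => (hl 𝔣 i).2 h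

theorem ofSubbasis_hasClearBasis : (ofSubbasis X B hB l hl).HasClearBasis :=
  hasClearBasis_of_eq_generateFrom (X := ofSubbasis X B hB l hl) hB (by
    rintro _ ⟨i, rfl⟩ x hx
    exact ⟨_, ofSubbasis_isClear X B hB l hl i, hx, subset_rfl⟩)

end OfSubbasis

end FilterAlgebra

/-! ### Equalisers of `T₀` spaces are embeddings. -/

namespace Top0

/-- The space with the same points as `X` and another `T₀` topology. -/
def withTopology (X : Top0.{u}) (τ : TopologicalSpace X.obj) (hτ : T0Space X.obj) : Top0.{u} :=
  ⟨@TopCat.of X.obj τ, hτ⟩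

theorem injective_of_mono {X Y : Top0.{u}} (f : X ⟶ Y) [Mono f] : Function.Injective (toMap f) := by
  intro x y h
  have := (cancel_mono f).1 (show ofHom (X := Top0.of PUnit.{u + 1}) (.const _ x) ≫ f =
    ofHom (.const _ y) ≫ f from hom_ext fun _ => h)
  exact congrArg (fun g : Top0.of PUnit ⟶ X => toMap g PUnit.unit) this

/-- An equaliser is a topological embedding. -/
theorem isInducing_of_isLimit_fork {X Y Z : Top0.{u}} {n : X ⟶ Y} {α β : Y ⟶ Z}
    (e : n ≫ α = n ≫ β) (h : Limits.IsLimit (Limits.Fork.ofι n e)) :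
    Topology.IsInducing (toMap n) := by
  have : Mono n := Limits.mono_of_isLimit_fork h
  have hinj := injective_of_mono n
  have hle := (toMap n).continuous.le_induced
  -- With the induced topology the same points still equalise `α` and `β`. The factorisation through
  -- `n` is the identity on points, so every open set of `X` is open for the induced topology.
  let τ : TopologicalSpace X.obj := Y.obj.str.induced (toMap n)
  have hτ : @T0Space X.obj τ := @Topology.IsEmbedding.t0Space _ _ τ _ _ _
    (@Topology.IsEmbedding.mk _ _ τ _ _ ⟨rfl⟩ hinj)
  let X' := X.withTopology τ hτ
  let m : X' ⟶ Y := ofHom (X := X') ⟨toMap n, continuous_induced_dom⟩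
  have hm : m ≫ α = m ≫ β := hom_ext fun x => congrArg (fun f : X ⟶ Z => toMap f x) e
  obtain ⟨t, ht⟩ := Limits.Fork.IsLimit.lift' h m hm
  have htx : ∀ x : X.obj, toMap t x = x := fun x =>
    hinj (congrArg (fun f : X' ⟶ Y => toMap f x) ht)
  refine @Topology.IsInducing.mk _ _ X.obj.str _ _ (le_antisymm hle fun s hs => ?_)
  have h : IsOpen[τ] ((fun x : X.obj => toMap t x) ⁻¹' s) :=
    IsOpen.preimage (toMap t).continuous hs
  rwa [show (fun x : X.obj => toMap t x) = id from funext htx] at h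

end Top0

/-! ### The Sierpiński algebra, its cotensor products, and `X_alg` as the algebras with a clear
base. -/

namespace FilterAlgebra

variable {k : FilterKind}

section Sierpinski

theorem sierpinski_str : (sierpinski.{u}).obj.str =
    generateFrom (Set.range fun _ : Unit => (sierpinskiOpen.{u} : Set (ULift.{u} Prop))) := by
  change induced ULift.down (generateFrom {{True}}) = _
  rw [induced_generateFrom_eq, Set.image_singleton, Set.range_const]
  congr 2
  ext p
  simp [sierpinskiOpen]

theorem isClear_sierpinskiOpen : IsClear (sierpinskiAlgebra.{u} k) sierpinskiOpen := fun _ h => h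

variable {X : FilterAlgebra.{u} k}

/-- The homomorphism that corresponds to a clear open set. -/
def charHom (U : Opens X.A.obj) (hU : X.IsClear U) : X ⟶ sierpinskiAlgebra k :=
  homMk (B := fun _ : Unit => sierpinskiOpen) (fun _ => isClear_sierpinskiOpen)
    (fun _ _ h => ext_of_subbasis sierpinski _ sierpinski_str h)
    (Top0.ofHom ⟨fun x => ULift.up (x ∈ U), continuous_uliftUp.comp (continuous_Prop.2 U.isOpen)⟩)
    fun _ => hU

/-- The clear open set that corresponds to a homomorphism. -/
def homOpens (f : X ⟶ sierpinskiAlgebra k) : Opens X.A.obj :=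
  Opens.comap (Top0.toMap f.f) sierpinskiOpen

theorem isClear_homOpens (f : X ⟶ sierpinskiAlgebra k) : X.IsClear (homOpens f) :=
  isClear_sierpinskiOpen.comap f

theorem sierpinski_hom_ext {f g : X ⟶ sierpinskiAlgebra k} (h : homOpens f = homOpens g) : f = g :=
  homExt fun x => ULift.ext _ _ (congrArg (fun U : Opens X.A.obj => x ∈ U) h)

theorem charHom_homOpens (f : X ⟶ sierpinskiAlgebra k) :
    charHom (homOpens f) (isClear_homOpens f) = f := sierpinski_hom_ext rfl

theorem le_iff_homOpens_le {f g : X ⟶ sierpinskiAlgebra k} : f ≤ g ↔ homOpens f ≤ homOpens g :=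
  ⟨fun h x hx => (show Top0.toMap g.f x ⤳ Top0.toMap f.f x from h x).mem_open
    sierpinskiOpen.isOpen hx,
    fun h _ => specializes_of_subbasis sierpinski _ sierpinski_str fun _ hx => h hx⟩

end Sierpinski

section Cotensor

/-- The monotone maps from a poset to the Sierpiński space. -/
def CotensorSpace (P : Type u) [PartialOrder P] : Type u := {φ : P → Prop // Monotone φ}

variable {P : Type u} [PartialOrder P]

instance : TopologicalSpace (CotensorSpace P) :=
  generateFrom (Set.range fun p : P => {φ | φ.1 p})

/-- The open set of maps that send a given element to the open point. -/
def CotensorSpace.evalOpen (p : P) : Opens (CotensorSpace P) :=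
  ⟨{φ | φ.1 p}, isOpen_generateFrom_of_mem ⟨p, rfl⟩⟩

instance : T0Space (CotensorSpace P) where
  t0 _ _ h := Subtype.ext (funext fun p => propext
    (h.mem_open_iff (CotensorSpace.evalOpen p).isOpen))

variable (k P) in
/-- The cotensor product of a poset and the Sierpiński space. -/
def cotensorAlgebra : FilterAlgebra.{u} k :=
  ofSubbasis (Top0.of (CotensorSpace P)) CotensorSpace.evalOpen rfl
    (fun 𝔣 => ⟨fun p => CotensorSpace.evalOpen p ∈ 𝔣, fun _ _ hpq =>
      OpenFilter.mem_of_le fun φ => φ.2 hpq⟩) fun _ _ => Iff.rfl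

theorem isClear_evalOpen (p : P) : (cotensorAlgebra k P).IsClear (CotensorSpace.evalOpen p) :=
  ofSubbasis_isClear _ _ _ _ _ p

/-- The projections of the cotensor product. -/
def cotensorProj (p : P) : cotensorAlgebra k P ⟶ sierpinskiAlgebra k :=
  charHom _ (isClear_evalOpen p)

theorem cotensorAlgebra_hasClearBasis : (cotensorAlgebra k P).HasClearBasis :=
  ofSubbasis_hasClearBasis _ _ _ _ _

/-- A monotone family of homomorphisms to the Sierpiński algebra is a monotone family of clear open
sets; the induced map sends a point to the predicate of belonging to the members of the family. -/
theorem isCotensor_cotensorAlgebra :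
    IsCotensor P (sierpinskiAlgebra.{u} k) (cotensorAlgebra k P) cotensorProj where
  mono p q h := le_iff_homOpens_le.2 fun φ => φ.2 h
  existsUnique_lift A a ha := by
    refine ⟨homMk (B := CotensorSpace.evalOpen) isClear_evalOpen
      (fun _ _ h => Subtype.ext (funext fun p => propext (h p)))
      (Top0.ofHom (Y := Top0.of (CotensorSpace P)) ⟨fun x => ⟨fun p => x ∈ homOpens (a p),
        fun _ _ h => fun hx => le_iff_homOpens_le.1 (ha h) hx⟩, continuous_generateFrom_iff.2 ?_⟩)
      fun p => isClear_homOpens (a p), fun p => sierpinski_hom_ext rfl, fun t ht => homExt fun x =>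
        Subtype.ext (funext fun p => ?_)⟩
    · rintro _ ⟨p, rfl⟩
      exact (homOpens (a p)).isOpen
    · exact congrArg (fun f : A ⟶ sierpinskiAlgebra k => x ∈ homOpens f) (ht p)
  le_of_comp_le A t t' h x := specializes_of_subbasis (Top0.of (CotensorSpace P))
    CotensorSpace.evalOpen rfl fun p hx => le_iff_homOpens_le.1 (h p) hx

end Cotensor

/-- The given cotensor product is a retract of the concrete one, whose clear base is pulled back
along the embedding `n` followed by the comparison `r`. -/
theorem hasClearBasis_of_isSierpinskiCogenerated {X : FilterAlgebra.{u} k}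
    (h : IsSierpinskiCogenerated X) : X.HasClearBasis := by
  obtain ⟨X₁, X₂, π₁, π₂, n, α, β, h₁, -, -, -, -, e, ⟨hlim⟩⟩ := h
  have hn := Top0.isInducing_of_isLimit_fork e hlim
  obtain ⟨s, hs, -⟩ := h₁.existsUnique_lift _ cotensorProj isCotensor_cotensorAlgebra.mono
  obtain ⟨r, hr, -⟩ := isCotensor_cotensorAlgebra.existsUnique_lift _ π₁ h₁.mono
  have hrs : r ≫ s = 𝟙 X₁ := (h₁.existsUnique_lift _ π₁ h₁.mono).unique
    (fun p => by rw [Category.assoc, hs, hr]) (fun p => Category.id_comp _)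
  have hrs' : ∀ y, Top0.toMap s.f (Top0.toMap r.f y) = y := fun y =>
    congrArg (fun f : X₁ ⟶ X₁ => Top0.toMap f.f y) hrs
  rintro x ⟨V, hV⟩ hx
  obtain ⟨V, hV', rfl⟩ := hn.isOpen_iff.1 hV
  obtain ⟨W, hW, hxW, hWV⟩ := cotensorAlgebra_hasClearBasis
    (Top0.toMap r.f (Top0.toMap n.f x)) (Opens.comap (Top0.toMap s.f) ⟨V, hV'⟩)
    (show Top0.toMap s.f _ ∈ V by rw [hrs']; exact hx)
  refine ⟨_, hW.comap (n ≫ r), hxW, fun y hy => ?_⟩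
  have : Top0.toMap s.f (Top0.toMap r.f (Top0.toMap n.f y)) ∈ V := hWV hy
  rwa [hrs'] at this

/-- A point of the cotensor product is a monotone predicate on clear open sets of `X`. Equalising
`α` and `β` forces it to respect finite meets and the joins that preserve clearness, so
`exists_point` finds the point of `X` behind it. -/
theorem HasClearBasis.isSierpinskiCogenerated {X : FilterAlgebra.{u} k} (hX : X.HasClearBasis) :
    IsSierpinskiCogenerated X := by
  let P := X ⟶ sierpinskiAlgebra k
  let X₁ := cotensorAlgebra k P
  let X₂ := cotensorAlgebra k (X₁ ⟶ sierpinskiAlgebra k)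
  have h₁ : IsCotensor P (sierpinskiAlgebra k) X₁ cotensorProj := isCotensor_cotensorAlgebra
  have h₂ : IsCotensor _ (sierpinskiAlgebra k) X₂ cotensorProj := isCotensor_cotensorAlgebra
  obtain ⟨n, hn, -⟩ := h₁.existsUnique_lift X id monotone_id
  obtain ⟨α, hα, -⟩ := h₂.existsUnique_lift X₁ id monotone_id
  obtain ⟨β, hβ, -⟩ := h₂.existsUnique_lift X₁ (fun g => cotensorProj (n ≫ g))
    fun g g' h => h₁.mono (OrderEnriched.comp_le_comp le_rfl h)
  have e : n ≫ α = n ≫ β := (h₂.existsUnique_lift X (fun g => n ≫ g)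
    fun g g' h => OrderEnriched.comp_le_comp le_rfl h).unique
      (fun g => by rw [Category.assoc, hα]; rfl) (fun g => by rw [Category.assoc, hβ, hn]; rfl)
  have e' : n.f ≫ α.f = n.f ≫ β.f := congrArg Monad.Algebra.Hom.f e
  refine ⟨X₁, X₂, cotensorProj, cotensorProj, n, α, β, h₁, h₂, hn, hα, hβ, e', ⟨?_⟩⟩
  have hnx : ∀ U (hU : X.IsClear U) x, x ∈ U ↔ (Top0.toMap n.f x).1 (charHom U hU) :=
    fun U hU x => iff_of_eq (congrArg (fun f : X ⟶ sierpinskiAlgebra k => x ∈ homOpens f)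
      (hn (charHom U hU)).symm)
  -- Comparing `α y` and `β y` at the component of `W`: membership of `y` in a clear set `W` depends
  -- only on the trace of `W` on `X`.
  have hclear : ∀ (y : CotensorSpace P), Top0.toMap α.f y = Top0.toMap β.f y →
      ∀ (W : Opens (CotensorSpace P)) (hW : X₁.IsClear W),
        y ∈ W ↔ y.1 (charHom _ (hW.comap n)) := by
    intro y hy W hW
    have hα' := congrArg (fun f : X₁ ⟶ sierpinskiAlgebra k => y ∈ homOpens f) (hα (charHom W hW))
    have hβ' := congrArg (fun f : X₁ ⟶ sierpinskiAlgebra k => y ∈ homOpens f) (hβ (charHom W hW))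
    have hy' : y ∈ homOpens (α ≫ cotensorProj (charHom W hW)) ↔
        y ∈ homOpens (β ≫ cotensorProj (charHom W hW)) :=
      iff_of_eq (congrArg (fun z : CotensorSpace (X₁ ⟶ sierpinskiAlgebra k) =>
        z ∈ CotensorSpace.evalOpen (charHom (X := X₁) W hW)) hy)
    exact ((iff_of_eq hα').symm.trans hy').trans (iff_of_eq hβ')
  have hpt : ∀ (y : CotensorSpace P), Top0.toMap α.f y = Top0.toMap β.f y →
      ∃ x : X.A.obj, ∀ U (hU : X.IsClear U), x ∈ U ↔ y.1 (charHom U hU) := by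
    intro y hy
    have key : ∀ (U : Opens X.A.obj) (hU : X.IsClear U) (W : Opens (CotensorSpace P))
        (hW : X₁.IsClear W), Opens.comap (Top0.toMap n.f) W = U →
        (y ∈ W ↔ y.1 (charHom U hU)) := by
      rintro _ hU W hW rfl
      exact hclear y hy W hW
    have hcomap : ∀ U (hU : X.IsClear U),
        Opens.comap (Top0.toMap n.f) (CotensorSpace.evalOpen (charHom U hU)) = U := fun U hU =>
      Opens.ext (Set.ext fun x => (hnx U hU x).symm)
    obtain ⟨x, hx⟩ := exists_point (fun U => ∃ hU : X.IsClear U, y.1 (charHom U hU))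
      (fun U V hU hV hUV ⟨_, h⟩ => ⟨hV, y.2
        (show charHom U hU ≤ charHom V hV from le_iff_homOpens_le.2 hUV) h⟩)
      ⟨isClear_top, (key ⊤ _ ⊤ isClear_top rfl).1 trivial⟩
      -- The intersection of the two evaluation sets is clear and has trace `U ⊓ V`, so `key`
      -- applies; joins in the prime case work in the same way.
      (fun U V hU hV ⟨_, h⟩ ⟨_, h'⟩ => ⟨hU.inf hV, (key _ _
        (CotensorSpace.evalOpen (charHom U hU) ⊓ CotensorSpace.evalOpen (charHom V hV))
        ((isClear_evalOpen _).inf (isClear_evalOpen _))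
        (congrArg₂ (· ⊓ ·) (hcomap U hU) (hcomap V hV))).1 ⟨h, h'⟩⟩)
      (fun hk ⟨_, h⟩ => (key ⊥ _ ⊥ (isClear_bot hk) rfl).2 h)
      (fun hk U V hU hV ⟨_, h⟩ => ((key _ _
        (CotensorSpace.evalOpen (charHom U hU) ⊔ CotensorSpace.evalOpen (charHom V hV))
        ((isClear_evalOpen _).sup hk (isClear_evalOpen _))
        (congrArg₂ (· ⊔ ·) (hcomap U hU) (hcomap V hV))).2 h).imp
          (fun h => ⟨hU, h⟩) (fun h => ⟨hV, h⟩))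
      (fun _ => hX)
    exact ⟨x, fun U hU => (hx U hU).trans ⟨fun ⟨_, h⟩ => h, fun h => ⟨hU, h⟩⟩⟩
  have hs : ∀ (s : Limits.Fork α.f β.f) (w : s.pt.obj), ∃ x : X.A.obj, ∀ U (hU : X.IsClear U),
      x ∈ U ↔ (show CotensorSpace P from Top0.toMap s.ι w).1 (charHom U hU) := fun s w =>
    hpt _ (congrArg (fun f : s.pt ⟶ X₂.A => Top0.toMap f w) s.condition)
  choose t ht using hs
  refine Limits.Fork.IsLimit.mk _ (fun s => Top0.ofHom ⟨t s, hX.continuous fun U hU => ?_⟩)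
    (fun s => Top0.hom_ext fun w => Subtype.ext (funext fun f => propext ?_))
    (fun s m hm => Top0.hom_ext fun w => hX.ext fun U hU => ?_)
  · convert ((CotensorSpace.evalOpen (charHom U hU)).isOpen.preimage
      (Top0.toMap s.ι).continuous) using 1
    ext w
    exact ht s w U hU
  · obtain ⟨U, hU, rfl⟩ : ∃ U hU, f = charHom U hU := ⟨_, _, (charHom_homOpens f).symm⟩
    exact (hnx U hU _).symm.trans (ht s w U hU)
  · refine Iff.trans ?_ (ht s w U hU).symm
    rw [← hm]
    exact hnx U hU _

theorem isSierpinskiCogenerated_iff {X : FilterAlgebra.{u} k} :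
    IsSierpinskiCogenerated X ↔ X.HasClearBasis :=
  ⟨hasClearBasis_of_isSierpinskiCogenerated, HasClearBasis.isSierpinskiCogenerated⟩

end FilterAlgebra

/-! ### Weighted limits of spaces and of algebras. -/

section WeightedLimits

variable {C : Type u₁} [Category.{v₁} C] [OrderEnriched C] {J : Type u₂} [Category.{v₂} J]
  {D : J ⥤ C} {W : J ⥤ PartOrd.{w}} {L : C} {l : ∀ d : J, W.obj d → (L ⟶ D.obj d)}

theorem IsWeightedLimit.hom_ext (h : IsWeightedLimit D W L l) {A : C} {t t' : A ⟶ L}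
    (ht : ∀ (d : J) (x : W.obj d), t ≫ l d x = t' ≫ l d x) : t = t' :=
  (h.le_of_comp_le A t t' fun d x => (ht d x).le).antisymm
    (h.le_of_comp_le A t' t fun d x => (ht d x).ge)

end WeightedLimits

section Monad

variable {C : Type u₁} [Category.{v₁} C] (T : Monad C) {A L : C} {X Y : T.Algebra}

theorem CategoryTheory.Monad.map_map_comp_comp (f : A ⟶ X.A) :
    T.map (T.map f ≫ X.a) ≫ X.a = T.μ.app A ≫ T.map f ≫ X.a := by
  have := T.μ.naturality_assoc f X.a
  rw [← this, X.assoc, Functor.map_comp, Category.assoc]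
  rfl

/-- The homomorphism from a free algebra which extends a given morphism. -/
def CategoryTheory.Monad.freeLift (f : A ⟶ X.A) : T.free.obj A ⟶ X where
  f := T.map f ≫ X.a
  h := T.map_map_comp_comp f

theorem CategoryTheory.Monad.freeLift_comp {f : A ⟶ X.A} {g : X ⟶ Y} {f' : A ⟶ Y.A}
    (h : f ≫ g.f = f') : T.freeLift f ≫ g = T.freeLift f' := by
  have : (T.map f ≫ X.a) ≫ g.f = T.map f' ≫ Y.a := by
    rw [← h, Functor.map_comp, Category.assoc, Category.assoc, g.h]
  exact Monad.Algebra.Hom.ext this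

theorem CategoryTheory.Monad.eta_freeLift (f : A ⟶ X.A) : T.η.app A ≫ (T.freeLift f).f = f := by
  have := T.η.naturality_assoc f X.a
  refine this.symm.trans ?_
  simp [X.unit]

/-- This and the next two lemmas verify the algebra and homomorphism equations after composition
with one map `l` compatible with the structures. Projections of a limit are jointly monic, so this
suffices there. -/
theorem CategoryTheory.Monad.unit_comp_of_comp_eq {a : T.obj L ⟶ L} {l : L ⟶ X.A}
    (h : a ≫ l = T.map l ≫ X.a) : (T.η.app L ≫ a) ≫ l = 𝟙 L ≫ l := by
  rw [Category.assoc, h, Category.id_comp]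
  exact T.eta_freeLift l

theorem CategoryTheory.Monad.assoc_comp_of_comp_eq {a : T.obj L ⟶ L} {l : L ⟶ X.A}
    (h : a ≫ l = T.map l ≫ X.a) : (T.μ.app L ≫ a) ≫ l = (T.map a ≫ a) ≫ l := by
  have := T.μ.naturality_assoc l X.a
  rw [Category.assoc, Category.assoc, h, ← Functor.map_comp_assoc, h]
  refine this.symm.trans ?_
  simp [X.assoc]

theorem CategoryTheory.Monad.map_comp_of_comp_eq {a : T.obj L ⟶ L} {b : T.obj A ⟶ A} {l : L ⟶ X.A}
    {t : A ⟶ L} (h : T.map l ≫ X.a = a ≫ l) (h' : T.map (t ≫ l) ≫ X.a = b ≫ t ≫ l) :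
    (T.map t ≫ a) ≫ l = (b ≫ t) ≫ l := by
  rw [Category.assoc, ← h, Category.assoc, ← h', Functor.map_comp, Category.assoc]

end Monad

namespace Top0

variable {J : Type u₂} [Category.{v₂} J] {D : J ⥤ Top0.{u}} {W : J ⥤ PartOrd.{w}} {L : Top0.{u}}
  {l : ∀ d : J, W.obj d → (L ⟶ D.obj d)}

/-- The projections of a weighted limit separate points. -/
theorem eq_of_isWeightedLimit (h : IsWeightedLimit D W L l) {x y : L.obj}
    (hxy : ∀ d i, toMap (l d i) x = toMap (l d i) y) : x = y := by
  have := h.hom_ext (t := ofHom (X := Top0.of PUnit.{u + 1}) (.const _ x))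
    (t' := ofHom (.const _ y)) fun d i => hom_ext fun _ => hxy d i
  exact congrArg (fun g : Top0.of PUnit ⟶ L => toMap g PUnit.unit) this

/-- A weighted limit carries the initial topology for its projections. -/
theorem str_eq_of_isWeightedLimit (h : IsWeightedLimit D W L l) :
    L.obj.str = generateFrom {s | ∃ d i, ∃ V : Set (D.obj d).obj, IsOpen V ∧
      s = toMap (l d i) ⁻¹' V} := by
  have hle : L.obj.str ≤ generateFrom {s | ∃ d i, ∃ V : Set (D.obj d).obj, IsOpen V ∧
      s = toMap (l d i) ⁻¹' V} := by
    rw [le_generateFrom_iff_subset_isOpen]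
    rintro _ ⟨d, i, V, hV, rfl⟩
    exact hV.preimage (toMap (l d i)).continuous
  refine le_antisymm hle ?_
  have hopen : ∀ d i (V : Set (D.obj d).obj), IsOpen V → IsOpen[generateFrom {s | ∃ d i,
      ∃ V : Set (D.obj d).obj, IsOpen V ∧ s = toMap (l d i) ⁻¹' V}] (toMap (l d i) ⁻¹' V) :=
    fun d i V hV => isOpen_generateFrom_of_mem ⟨d, i, V, hV, rfl⟩
  generalize generateFrom {s | ∃ d i, ∃ V : Set (D.obj d).obj, IsOpen V ∧
      s = toMap (l d i) ⁻¹' V} = τ at hopen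
  have hτ : @T0Space L.obj τ := by
    refine @T0Space.mk _ τ fun x y hxy => eq_of_isWeightedLimit h fun d i => ?_
    refine Inseparable.eq (inseparable_iff_forall_isOpen.2 fun V hV => ?_)
    exact (@inseparable_iff_forall_isOpen _ τ _ _).1 hxy _ (hopen d i V hV)
  -- The points of `L` with the initial topology still form a cone. The induced map to `L` is the
  -- identity on points, and its continuity gives the missing inclusion of topologies.
  let L' := L.withTopology τ hτ
  let l' : ∀ d, W.obj d → (L' ⟶ D.obj d) := fun d i =>
    ofHom (X := L') (@ContinuousMap.mk _ _ τ _ (toMap (l d i))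
      (@Continuous.mk _ _ τ _ _ (hopen d i)))
  obtain ⟨t, ht, -⟩ := h.existsUnique_lift L' l'
    ⟨fun d x y hxy => h.mono d x y hxy, fun d d' n x => hom_ext fun p =>
      congrArg (fun f : L ⟶ D.obj d' => toMap f p) (h.naturality d d' n x)⟩
  have htx : ∀ x : L.obj, toMap t x = x := fun x => eq_of_isWeightedLimit h fun d i =>
    congrArg (fun f : L' ⟶ D.obj d => toMap f x) (ht d i)
  intro s hs
  have h : IsOpen[τ] ((fun x : L.obj => toMap t x) ⁻¹' s) :=
    (@continuous_def _ _ τ L.obj.str _).1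
      (@ContinuousMap.continuous _ _ τ L.obj.str (toMap t)) s hs
  rwa [show (fun x : L.obj => toMap t x) = id from funext htx] at h

end Top0

namespace FilterAlgebra

variable {k : FilterKind}

section WeightedLimits

variable {J : Type u₂} [Category.{v₂} J] {D : J ⥤ FilterAlgebra.{u} k} {W : J ⥤ PartOrd.{w}}

/-- The forgetful functor preserves weighted limits. -/
theorem isWeightedLimit_forget {L : FilterAlgebra.{u} k} {l : ∀ d : J, W.obj d → (L ⟶ D.obj d)}
    (h : IsWeightedLimit D W L l) :
    IsWeightedLimit (D ⋙ (filterMonad k).forget) W L.A fun d x => (l d x).f := by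
  let T := filterMonad.{u} k
  have hmono : ∀ {A : Top0.{u}} {X : FilterAlgebra.{u} k} {f g : A ⟶ X.A}, f ≤ g →
      T.freeLift f ≤ T.freeLift g := fun h =>
    OrderEnriched.comp_le_comp (C := Top0.{u}) (Top0.filterMonad_map_mono h) le_rfl
  refine ⟨⟨fun d x y hxy => h.mono d x y hxy, fun d d' n x =>
    congrArg Monad.Algebra.Hom.f (h.naturality d d' n x)⟩, fun A a ha => ?_, fun A t t' ht => ?_⟩
  -- Cones from a space `A` are transposed to cones of homomorphisms from the free algebra on `A`,
  -- monotonically in both directions.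
  · obtain ⟨t, ht, huniq⟩ := h.existsUnique_lift (T.free.obj A)
      (fun d x => T.freeLift (X := D.obj d) (a d x))
      ⟨fun d x y hxy => hmono (ha.mono d x y hxy), fun d d' n x =>
        T.freeLift_comp (ha.naturality d d' n x)⟩
    refine ⟨T.η.app A ≫ t.f, fun d x => ?_, fun t' ht' => ?_⟩
    · refine Eq.trans ?_ (T.eta_freeLift (X := D.obj d) (a d x))
      rw [← ht d x]
      rfl
    · rw [← huniq (T.freeLift (X := L) t') fun d x => T.freeLift_comp (ht' d x)]
      exact (T.eta_freeLift (X := L) t').symm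
  · have hle : (T.freeLift (X := L) t).f ≤ (T.freeLift (X := L) t').f :=
      h.le_of_comp_le _ (T.freeLift (X := L) t) (T.freeLift (X := L) t') fun d x => by
        rw [T.freeLift_comp rfl, T.freeLift_comp rfl]
        exact hmono (ht d x)
    have := OrderEnriched.comp_le_comp (C := Top0.{u}) (le_refl (T.η.app A)) hle
    have h₁ := T.eta_freeLift (X := L) t
    have h₂ := T.eta_freeLift (X := L) t'
    exact h₁.symm.trans_le (this.trans_eq h₂)

/-- The forgetful functor creates weighted limits. -/
theorem exists_algebra_of_isWeightedLimit {L : Top0.{u}} {l : ∀ d : J, W.obj d → (L ⟶ (D.obj d).A)}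
    (h : IsWeightedLimit (D ⋙ (filterMonad k).forget) W L l) :
    ∃ (a : (filterMonad k).obj L ⟶ L) (_ : (filterMonad k).η.app L ≫ a = 𝟙 L)
      (_ : (filterMonad k).μ.app L ≫ a = (filterMonad k).map a ≫ a),
      ∀ d x, (filterMonad k).map (l d x) ≫ (D.obj d).a = a ≫ l d x := by
  let T := filterMonad.{u} k
  -- The structure map is the only one for which all projections can be homomorphisms.
  obtain ⟨a, ha, -⟩ := h.existsUnique_lift (T.obj L) (fun d x => T.map (l d x) ≫ (D.obj d).a)
    ⟨fun d x y hxy => OrderEnriched.comp_le_comp (Top0.filterMonad_map_mono (h.mono d x y hxy))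
      le_rfl, fun d d' n x => congrArg Monad.Algebra.Hom.f
        (T.freeLift_comp (X := D.obj d) (Y := D.obj d') (h.naturality d d' n x))⟩
  exact ⟨a, h.hom_ext fun d x => T.unit_comp_of_comp_eq (X := D.obj d) (ha d x),
    h.hom_ext fun d x => T.assoc_comp_of_comp_eq (X := D.obj d) (ha d x), fun d x => (ha d x).symm⟩

/-- A weighted limit of algebras with a base of clear open sets is such an algebra. -/
theorem hasClearBasis_of_isWeightedLimit {L : FilterAlgebra.{u} k}
    {l : ∀ d : J, W.obj d → (L ⟶ D.obj d)} (hD : ∀ d, (D.obj d).HasClearBasis)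
    (h : IsWeightedLimit (D ⋙ (filterMonad k).forget) W L.A fun d x => (l d x).f) :
    L.HasClearBasis := by
  refine hasClearBasis_of_eq_generateFrom (Top0.str_eq_of_isWeightedLimit h) ?_
  rintro _ ⟨d, i, V, hV, rfl⟩ x hx
  obtain ⟨U, hU, hxU, hUV⟩ := hD d _ ⟨V, hV⟩ hx
  exact ⟨_, hU.comap (l d i), hxU, fun y hy => hUV hy⟩

end WeightedLimits

/-- Uniqueness of algebra structures allows membership to be tested with the given structures on
source and target. -/
theorem xAlgTop_hom_iff {X Y : FilterAlgebra.{u} k} {f : X.A ⟶ Y.A} :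
    (xAlgTop k).hom f ↔ X.HasClearBasis ∧ Y.HasClearBasis ∧
      (filterMonad k).map f ≫ Y.a = X.a ≫ f := by
  constructor
  · rintro ⟨X', Y', hX, hY, f', ⟨hX', hY'⟩, rfl⟩
    obtain rfl := filterMonad_forget_obj_injective k hX
    obtain rfl := filterMonad_forget_obj_injective k hY
    exact ⟨isSierpinskiCogenerated_iff.1 hX', isSierpinskiCogenerated_iff.1 hY',
      f'.h⟩
  · rintro ⟨hX, hY, hf⟩
    exact ⟨X, Y, rfl, rfl, ⟨f, hf⟩, ⟨isSierpinskiCogenerated_iff.2 hX,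
      isSierpinskiCogenerated_iff.2 hY⟩, rfl⟩

theorem xAlgTop_obj_iff {X : Top0.{u}} :
    (xAlgTop k).obj X ↔ ∃ X' : FilterAlgebra.{u} k, X'.HasClearBasis ∧ X'.A = X :=
  exists_congr fun _ => and_congr_left fun _ => isSierpinskiCogenerated_iff

/-- A diagram of spaces in `X_alg` is a diagram of algebras. -/
theorem exists_lift_diagram {J : Type u₂} [Category.{v₂} J] {D : J ⥤ Top0.{u}}
    (h : (xAlgTop k).ContainsImage D) : ∃ D' : J ⥤ FilterAlgebra.{u} k,
      (∀ d, (D'.obj d).HasClearBasis) ∧ D' ⋙ (filterMonad k).forget = D := by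
  have hobj : ∀ X : Top0.{u}, (xAlgTop k).obj X → ∃ (a : (filterMonad k).obj X ⟶ X)
      (h₁ : (filterMonad k).η.app X ≫ a = 𝟙 X)
      (h₂ : (filterMonad k).μ.app X ≫ a = (filterMonad k).map a ≫ a),
      HasClearBasis (⟨X, a, h₁, h₂⟩ : FilterAlgebra.{u} k) := by
    intro X hX
    obtain ⟨X', hX', rfl⟩ := xAlgTop_obj_iff.1 hX
    exact ⟨X'.a, X'.unit, X'.assoc, hX'⟩
  choose a h₁ h₂ ha using fun d => hobj _ (h.1 d)
  let E : J → FilterAlgebra.{u} k := fun d => ⟨D.obj d, a d, h₁ d, h₂ d⟩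
  exact ⟨{ obj := E
           map {d d'} f := ⟨D.map f, (xAlgTop_hom_iff (X := E d) (Y := E d').1 (h.2 d d' f)).2.2⟩
           map_id d := Monad.Algebra.Hom.ext (D.map_id d)
           map_comp f g := Monad.Algebra.Hom.ext (D.map_comp f g) }, ha, rfl⟩

theorem xAlg_closedUnderWeightedLimits : (xAlg.{u} k).ClosedUnderWeightedLimits := by
  intro J _ _ D W _ _ hD L l hl
  have hL : IsSierpinskiCogenerated L := isSierpinskiCogenerated_iff.2
    (hasClearBasis_of_isWeightedLimit (fun d => isSierpinskiCogenerated_iff.1 (hD.1 d))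
      (isWeightedLimit_forget hl))
  exact ⟨hL, fun d _ => ⟨hL, hD.1 d⟩, fun _ _ hB _ => ⟨hB, hL⟩⟩

theorem xAlgTop_closedUnderWeightedLimits : (xAlgTop.{u} k).ClosedUnderWeightedLimits := by
  intro J _ _ D W _ _ hD L l hl
  obtain ⟨D, hD', rfl⟩ := exists_lift_diagram hD
  obtain ⟨a, h₁, h₂, hX⟩ := exists_algebra_of_isWeightedLimit hl
  let X : FilterAlgebra.{u} k := ⟨L, a, h₁, h₂⟩
  have hclear : X.HasClearBasis :=
    hasClearBasis_of_isWeightedLimit (l := fun d x => ⟨l d x, hX d x⟩) hD' hl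
  refine ⟨xAlgTop_obj_iff.2 ⟨X, hclear, rfl⟩, fun d x => xAlgTop_hom_iff (X := X).2 ⟨hclear, hD' d, hX d x⟩,
    fun B t hB ht => ?_⟩
  obtain ⟨Y, hY, rfl⟩ := xAlgTop_obj_iff.1 hB
  exact xAlgTop_hom_iff (Y := X).2 ⟨hY, hclear, hl.hom_ext fun d x =>
    Monad.map_comp_of_comp_eq (X := D.obj d) _ (hX d x)
      (xAlgTop_hom_iff (X := Y) (Y := D.obj d).1 (ht d x)).2.2⟩

end FilterAlgebra

/-! ### The generator space and its filters. -/

/-- A space of which the free algebra is the square of the Sierpiński algebra: a subspace of the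
square of the Sierpiński space. -/
def GeneratorSpace (k : FilterKind) : Type u :=
  {y : ULift.{u} (Bool → Prop) // (k ≠ .prime → ∃ b, y.down b) ∧ (k = .all → ∃ b, ¬ y.down b)}

namespace GeneratorSpace

variable {k : FilterKind}

instance : TopologicalSpace (GeneratorSpace.{u} k) :=
  generateFrom (Set.range fun b : Bool => {y | y.1.down b})

/-- The open set of points of which a given coordinate is the open point. -/
def coord (b : Bool) : Opens (GeneratorSpace.{u} k) :=
  ⟨{y | y.1.down b}, isOpen_generateFrom_of_mem ⟨b, rfl⟩⟩

instance : T0Space (GeneratorSpace.{u} k) where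
  t0 _ _ h := Subtype.ext (ULift.ext _ _ (funext fun b => propext
    (h.mem_open_iff (coord b).isOpen)))

theorem mem_of_le {C : Opens (GeneratorSpace.{u} k)} {y z : GeneratorSpace.{u} k} (hy : y ∈ C)
    (h : ∀ b, y.1.down b → z.1.down b) : z ∈ C :=
  (FilterAlgebra.specializes_of_subbasis (Top0.of (GeneratorSpace.{u} k)) coord rfl
    fun b hb => h b hb).mem_open C.isOpen hy

/-- The filter of open sets that contain all points above a given pair. -/
def above (p : Bool → Prop) : OpenFilter k (GeneratorSpace.{u} k) :=
  .mk {C | ∀ y : GeneratorSpace k, (∀ b, p b → y.1.down b) → y ∈ C} (fun _ _ => trivial)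
    (fun h hU y hy => h (hU y hy)) (fun hU hV y hy => ⟨hU y hy, hV y hy⟩)
    (fun hk h => h ⟨⟨fun _ => True⟩, fun _ => ⟨true, trivial⟩, fun h => absurd h hk⟩
      fun _ _ => trivial)
    (fun hk U V h => by
      -- In the prime case all four pairs are points, so this is the neighbourhood filter of `p`.
      let y : GeneratorSpace.{u} k := ⟨⟨p⟩, fun h => absurd hk h, fun h => by simp [h] at hk⟩
      exact (h y fun _ => id).imp (fun hU z hz => mem_of_le hU hz) (fun hV z hz => mem_of_le hV hz))

theorem coord_mem_above {p : Bool → Prop} {b : Bool} :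
    coord b ∈ (above p : OpenFilter k (GeneratorSpace.{u} k)) ↔ p b := by
  refine ⟨fun h => ?_, fun h y hy => hy b h⟩
  by_contra hp
  -- The pair that is false at `b` only has one true and one false coordinate, hence is a point for
  -- every kind.
  exact h ⟨⟨fun c => c ≠ b⟩, fun _ => ⟨!b, by simp⟩, fun _ => ⟨b, by simp⟩⟩
    (fun c hc hcb => hp (hcb ▸ hc)) rfl

theorem above_mono {p q : Bool → Prop} (h : ∀ b, p b → q b) {C : Opens (GeneratorSpace.{u} k)}
    (hC : C ∈ (above p : OpenFilter k (GeneratorSpace.{u} k))) :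
    C ∈ (above q : OpenFilter k (GeneratorSpace.{u} k)) :=
  fun y hy => hC y fun b hb => hy b (h b hb)

/-- A filter is determined by which of the two coordinate sets it contains, so that there are four
filters for every kind. This is why the space has four points for prime filters, loses the all-false
pair for proper filters, and loses the all-true pair too when all filters are allowed. -/
theorem filter_eq_above (𝔣 : OpenFilter k (GeneratorSpace.{u} k)) :
    𝔣 = above fun b => coord b ∈ 𝔣 := by
  ext C
  constructor
  · intro hC y hy
    by_contra hyC
    -- Thus `C` is covered by the coordinate sets that do not contain `y`, none of which is in `𝔣`.
    -- No such set contradicts properness, one contradicts upward closure, two contradict primality;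
    -- the definition of the space excludes the cases where these are not available.
    have hle : ∀ z ∈ C, ∃ b, ¬ y.1.down b ∧ z.1.down b := by
      intro z hz
      by_contra! h
      exact hyC (mem_of_le hz fun b hb => by_contra fun hb' => h b hb' hb)
    have key : ∀ b, ¬ y.1.down b → coord b ∉ 𝔣 := fun b hb h => hb (hy b h)
    by_cases h₁ : y.1.down true <;> by_cases h₂ : y.1.down false
    · have hk : k ≠ .all := fun hk => by
        obtain ⟨b, hb⟩ := y.2.2 hk
        cases b <;> contradiction
      refine 𝔣.bot_notMem hk (OpenFilter.mem_of_le (fun z hz => ?_) hC)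
      obtain ⟨b, hb, -⟩ := hle z hz
      cases b <;> contradiction
    · refine key false h₂ (OpenFilter.mem_of_le (fun z hz => ?_) hC)
      obtain ⟨b, hb, hz⟩ := hle z hz
      cases b
      exacts [hz, absurd h₁ hb]
    · refine key true h₁ (OpenFilter.mem_of_le (fun z hz => ?_) hC)
      obtain ⟨b, hb, hz⟩ := hle z hz
      cases b
      exacts [absurd h₂ hb, hz]
    · have hk : k = .prime := by
        by_contra hk
        obtain ⟨b, hb⟩ := y.2.1 hk
        cases b <;> contradiction
      refine (𝔣.mem_or_mem hk (coord true) (coord false)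
        (OpenFilter.mem_of_le (fun z hz => ?_) hC)).elim (key true h₁) (key false h₂)
      obtain ⟨b, -, hz⟩ := hle z hz
      cases b
      exacts [Or.inr hz, Or.inl hz]
  · intro hC
    have h : ∀ b, ∃ V ∈ 𝔣, ∀ y ∈ V, coord b ∈ 𝔣 → y.1.down b := fun b => by
      by_cases hb : coord b ∈ 𝔣
      · exact ⟨_, hb, fun y hy _ => hy⟩
      · exact ⟨⊤, 𝔣.top_mem, fun y _ h => absurd h hb⟩
    obtain ⟨V, hV, hV'⟩ := h true
    obtain ⟨V₂, hV₂, hV₂'⟩ := h false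
    refine OpenFilter.mem_of_le (fun y hy => hC y fun b => ?_) (OpenFilter.inf_mem hV hV₂)
    cases b
    exacts [hV₂' y hy.2, hV' y hy.1]

theorem filter_ext {𝔣 𝔤 : OpenFilter k (GeneratorSpace.{u} k)}
    (h : ∀ b, coord b ∈ 𝔣 ↔ coord b ∈ 𝔤) : 𝔣 = 𝔤 := by
  rw [filter_eq_above 𝔣, filter_eq_above 𝔤]
  exact congrArg above (funext fun b => propext (h b))

end GeneratorSpace

/-! ### Codensity of the generator and the closure under weighted limits. -/

namespace FilterAlgebra

open GeneratorSpace

variable {k : FilterKind} {X A : FilterAlgebra.{u} k}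

theorem isClear_sharp {Y : Top0.{u}} (C : Opens Y.obj) :
    IsClear (k := k) ((filterMonad k).free.obj Y) (OpenFilter.sharp C) := fun _ h => h

theorem free_hasClearBasis (Y : Top0.{u}) :
    HasClearBasis (k := k) ((filterMonad k).free.obj Y) := fun 𝔣 V h𝔣 => by
  obtain ⟨C, hC, hCV⟩ := OpenFilter.exists_sharp_subset V.isOpen h𝔣
  exact ⟨OpenFilter.sharp C, isClear_sharp C, hC, hCV⟩

variable (k) in
/-- The free algebra on the generator space. -/
abbrev generator : FilterAlgebra.{u} k := (filterMonad k).free.obj (Top0.of (GeneratorSpace.{u} k))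

/-- The clear open set of filters that contain a given open set. -/
abbrev generatorOpen (C : Opens (GeneratorSpace.{u} k)) : Opens (generator.{u} k).A.obj :=
  OpenFilter.sharp C

theorem isClear_generatorOpen (C : Opens (GeneratorSpace.{u} k)) :
    (generator k).IsClear (generatorOpen C) := fun _ h => h

theorem comap_generatorOpen_top (f : X ⟶ generator k) :
    Opens.comap (Top0.toMap f.f) (generatorOpen ⊤) = ⊤ :=
  Opens.ext (Set.ext fun x => iff_of_true
    (show OpenFilter k (GeneratorSpace.{u} k) from Top0.toMap f.f x).top_mem trivial)

theorem comap_generatorOpen_bot (hk : k ≠ .all) (f : X ⟶ generator k) :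
    Opens.comap (Top0.toMap f.f) (generatorOpen ⊥) = ⊥ :=
  Opens.ext (Set.ext fun x => iff_of_false
    ((show OpenFilter k (GeneratorSpace.{u} k) from Top0.toMap f.f x).bot_notMem hk) id)

theorem generator_hom_ext {f g : X ⟶ generator k}
    (h : ∀ b, Opens.comap (Top0.toMap f.f) (generatorOpen (coord b)) =
      Opens.comap (Top0.toMap g.f) (generatorOpen (coord b))) : f = g :=
  homExt fun x => GeneratorSpace.filter_ext fun b =>
    iff_of_eq (congrArg (fun U : Opens X.A.obj => x ∈ U) (h b))

/-- The homomorphism to the free algebra on the generator space that corresponds to a pair of clear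
open sets. -/
def pairHom (U : Bool → Opens X.A.obj) (hU : ∀ b, X.IsClear (U b)) : X ⟶ generator k :=
  homMk (Y := generator k) (B := fun b => generatorOpen (coord b)) (fun b => isClear_generatorOpen (coord b))
    (fun _ _ h => GeneratorSpace.filter_ext h)
    (Top0.ofHom (Y := (generator k).A) ⟨fun x => above fun b => x ∈ U b,
      OpenFilter.continuous_of_preimage_sharp fun C => by
        rw [isOpen_iff_forall_mem_open]
        intro x hx
        have h : ∀ b, ∃ V : Opens X.A.obj, x ∈ V ∧ ∀ z ∈ V, x ∈ U b → z ∈ U b := fun b => by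
          by_cases hb : x ∈ U b
          · exact ⟨_, hb, fun y hy _ => hy⟩
          · exact ⟨⊤, trivial, fun y _ h => absurd h hb⟩
        obtain ⟨V, hV, hV'⟩ := h true
        obtain ⟨V₂, hV₂, hV₂'⟩ := h false
        refine ⟨V ⊓ V₂, fun z hz => above_mono (fun b => ?_) hx, (V ⊓ V₂).isOpen, hV, hV₂⟩
        cases b
        exacts [hV₂' z hz.2, hV' z hz.1]⟩)
    fun b => by
      convert hU b using 1
      ext x
      exact coord_mem_above (p := fun b => x ∈ U b)

theorem mem_comap_pairHom {U : Bool → Opens X.A.obj} {hU : ∀ b, X.IsClear (U b)} {b : Bool}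
    {x : X.A.obj} : x ∈ Opens.comap (Top0.toMap (pairHom U hU).f) (generatorOpen (coord b)) ↔
      x ∈ U b :=
  coord_mem_above (p := fun b => x ∈ U b)

theorem comap_pairHom (U : Bool → Opens X.A.obj) (hU : ∀ b, X.IsClear (U b)) (b : Bool) :
    Opens.comap (Top0.toMap (pairHom U hU).f) (generatorOpen (coord b)) = U b :=
  Opens.ext (Set.ext fun _ => mem_comap_pairHom)

theorem pairHom_mono {U V : Bool → Opens X.A.obj} {hU : ∀ b, X.IsClear (U b)}
    {hV : ∀ b, X.IsClear (V b)} (h : ∀ b, U b ≤ V b) : pairHom U hU ≤ pairHom V hV := by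
  intro x
  change (above fun b => x ∈ V b : OpenFilter k (GeneratorSpace.{u} k)) ⤳ above fun b => x ∈ U b
  rw [specializes_iff_forall_open]
  intro W hW hx
  obtain ⟨C, hC, hCW⟩ := OpenFilter.exists_sharp_subset hW hx
  exact hCW _ (above_mono (fun b hb => h b hb) hC)

theorem comap_mono_of_le {f g : X ⟶ A} (h : f ≤ g) (U : Opens A.A.obj) :
    Opens.comap (Top0.toMap f.f) U ≤ Opens.comap (Top0.toMap g.f) U := fun x hx =>
  (show Top0.toMap g.f x ⤳ Top0.toMap f.f x from h x).mem_open U.isOpen hx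

/-- The generator is codense among the algebras with a base of clear open sets. -/
theorem exists_lift_of_generator (hX : X.HasClearBasis)
    (a : (X ⟶ generator k) → (A ⟶ generator k)) (ha : Monotone a)
    (hnat : ∀ g (h : generator k ⟶ generator k), a g ≫ h = a (g ≫ h)) :
    ∃ t : A ⟶ X, ∀ g, t ≫ g = a g := by
  -- The cone induces a map from clear open sets of `X` to those of `A`, read off from the diagonal
  -- pairs `(U, U)`; it will be the preimage map of the lift.
  let aO : ∀ U : Opens X.A.obj, X.IsClear U → Opens A.A.obj := fun U hU =>
    Opens.comap (Top0.toMap (a (pairHom (fun _ => U) fun _ => hU)).f) (generatorOpen (coord true))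
  have haO : ∀ U hU, A.IsClear (aO U hU) := fun U hU => (isClear_generatorOpen (coord true)).comap _
  have key : ∀ (g : X ⟶ generator k) (C : Opens (GeneratorSpace k)) (U : Opens X.A.obj)
      (hU : X.IsClear U), Opens.comap (Top0.toMap g.f) (generatorOpen C) = U →
      Opens.comap (Top0.toMap (a g).f) (generatorOpen C) = aO U hU := by
    rintro g C _ hU rfl
    -- Naturality for the endomorphism with both coordinates equal to the set given by `C` replaces
    -- `g` by the diagonal pair.
    let h : generator k ⟶ generator k :=
      pairHom (X := generator k) (fun _ => generatorOpen C) fun _ => isClear_generatorOpen C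
    have hh : ∀ b, Opens.comap (Top0.toMap h.f) (generatorOpen (coord b)) = generatorOpen C :=
      fun b => comap_pairHom (X := generator k) _ (fun _ => isClear_generatorOpen C) b
    have hg : g ≫ h = pairHom _ fun _ => hU := generator_hom_ext fun b => by
      rw [comap_pairHom]
      exact congrArg (Opens.comap (Top0.toMap g.f)) (hh b)
    refine Eq.trans ?_ (congrArg (fun f : A ⟶ generator k =>
      Opens.comap (Top0.toMap f.f) (generatorOpen (coord true))) ((hnat g h).trans (congrArg a hg)))
    exact congrArg (Opens.comap (Top0.toMap (a g).f)) (hh true).symm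
  have hpt : ∀ z, ∃ x, ∀ U (hU : X.IsClear U), x ∈ U ↔ z ∈ aO U hU := by
    intro z
    have hpair : ∀ U V (hU : X.IsClear U) (hV : X.IsClear V), ∃ g : X ⟶ generator k,
        (Opens.comap (Top0.toMap g.f) (generatorOpen (coord true)) = U) ∧
        (Opens.comap (Top0.toMap g.f) (generatorOpen (coord false)) = V) := fun U V hU hV =>
      have h : ∀ b, X.IsClear (bif b then U else V) := fun b => by cases b <;> assumption
      ⟨pairHom _ h, comap_pairHom _ h true, comap_pairHom _ h false⟩
    -- The lattice laws come from `key` with `C` equal to `⊤`, `⊥`, the intersection of the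
    -- coordinate sets, and their union. Two coordinates are what the binary operations need.
    obtain ⟨x, hx⟩ := exists_point (X := X) (fun U => ∃ hU : X.IsClear U, z ∈ aO U hU)
      (fun U V hU hV hUV ⟨_, h⟩ => ⟨hV, comap_mono_of_le (ha (pairHom_mono fun _ => hUV)) _ h⟩)
      ⟨isClear_top, by
        rw [← key (pairHom (fun _ => ⊤) fun _ => isClear_top) ⊤ ⊤ isClear_top
          (comap_generatorOpen_top _), comap_generatorOpen_top]
        trivial⟩
      (fun U V hU hV ⟨_, h⟩ ⟨_, h'⟩ => ⟨hU.inf hV, by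
        obtain ⟨g, h₁, h₂⟩ := hpair U V hU hV
        rw [← key g _ U hU h₁] at h
        rw [← key g _ V hV h₂] at h'
        rw [← key g (coord true ⊓ coord false) _ (hU.inf hV) (by
          rw [← h₁, ← h₂]
          exact Opens.ext (Set.ext fun x => ⟨fun h => ⟨OpenFilter.mem_of_le inf_le_left h,
            OpenFilter.mem_of_le inf_le_right h⟩, fun h => OpenFilter.inf_mem h.1 h.2⟩))]
        exact OpenFilter.inf_mem h h'⟩)
      (fun hk ⟨h, hz⟩ => by
        rw [← key (pairHom (fun _ => ⊤) fun _ => isClear_top) ⊥ ⊥ h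
          (comap_generatorOpen_bot hk _), comap_generatorOpen_bot hk] at hz
        exact hz)
      (fun hk U V hU hV ⟨hUV, hz⟩ => by
        obtain ⟨g, h₁, h₂⟩ := hpair U V hU hV
        rw [← key g (coord true ⊔ coord false) _ hUV (by
          rw [← h₁, ← h₂]
          exact Opens.ext (Set.ext fun x => ⟨OpenFilter.mem_or_mem hk _ _ _, fun h => h.elim
            (OpenFilter.mem_of_le le_sup_left) (OpenFilter.mem_of_le le_sup_right)⟩))] at hz
        refine (OpenFilter.mem_or_mem hk _ _ _ hz).imp (fun h => ⟨hU, ?_⟩) (fun h => ⟨hV, ?_⟩)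
        · rw [← key g _ U hU h₁]
          exact h
        · rw [← key g _ V hV h₂]
          exact h)
      fun _ => hX
    exact ⟨x, fun U hU => (hx U hU).trans ⟨fun ⟨_, h⟩ => h, fun h => ⟨hU, h⟩⟩⟩
  choose t ht using hpt
  have htO : ∀ U (hU : X.IsClear U), t ⁻¹' U = aO U hU := fun U hU => Set.ext fun z => ht z U hU
  let tc : C(A.A.obj, X.A.obj) := ⟨t, hX.continuous fun U hU => by
    change IsOpen (t ⁻¹' U)
    rw [htO U hU]
    exact (aO U hU).isOpen⟩
  have htc : ∀ U (hU : X.IsClear U), Opens.comap tc U = aO U hU := fun U hU => Opens.ext (htO U hU)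
  refine ⟨hX.homMk (Top0.ofHom tc) fun U hU => ?_, fun g => generator_hom_ext fun b => ?_⟩
  · exact (htc U hU) ▸ haO U hU
  · exact (htc _ ((isClear_generatorOpen (coord b)).comap g)).trans (key g (coord b) _ _ rfl).symm

theorem le_of_generator (hX : X.HasClearBasis) {t t' : A ⟶ X}
    (h : ∀ g : X ⟶ generator k, t ≫ g ≤ t' ≫ g) : t ≤ t' := by
  suffices hs : ∀ z, Top0.toMap t'.f z ⤳ Top0.toMap t.f z from hs
  intro z
  refine hX.specializes_iff.2 fun U hU hz => ?_
  have hle := comap_mono_of_le (h (pairHom (fun _ => U) fun _ => hU)) (generatorOpen (coord true))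
  have hz' : Top0.toMap t.f z ∈ Opens.comap (Top0.toMap (pairHom (fun _ => U) fun _ => hU).f)
    (generatorOpen (coord true)) := mem_comap_pairHom.2 hz
  exact (mem_comap_pairHom (X := X) (U := fun _ => U) (hU := fun _ => hU) (b := true)).1 (hle hz')

variable (k) in
/-- The endomorphisms of the generator, as a category with one object. -/
abbrev GeneratorCat : Type u :=
  InducedCategory (FilterAlgebra.{u} k) fun _ : PUnit.{u + 1} => generator k

instance : OrderEnriched (GeneratorCat.{u} k) where
  homOrder _ _ := PartialOrder.lift (fun f => f.hom) fun _ _ h => InducedCategory.hom_ext h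
  comp_le_comp hf hg := OrderEnriched.comp_le_comp (C := FilterAlgebra.{u} k) hf hg

variable (k) in
/-- The inclusion of the generator among the algebras. -/
abbrev generatorDiagram : GeneratorCat.{u} k ⥤ FilterAlgebra.{u} k := inducedFunctor _

/-- The homomorphisms from an algebra to the generator, as a weight. -/
def generatorWeight (X : FilterAlgebra.{u} k) : GeneratorCat.{u} k ⥤ PartOrd.{u} where
  obj _ := PartOrd.of (X ⟶ generator k)
  map f := PartOrd.ofHom ⟨fun g => g ≫ f.hom, fun _ _ h =>
    OrderEnriched.comp_le_comp (C := FilterAlgebra.{u} k) h le_rfl⟩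

theorem isWeightedLimit_generator (hX : X.HasClearBasis) :
    IsWeightedLimit (generatorDiagram.{u} k) (generatorWeight X) X fun _ g => g where
  mono _ _ _ h := h
  naturality _ _ _ _ := rfl
  existsUnique_lift A a ha := by
    obtain ⟨t, ht⟩ := exists_lift_of_generator hX (a PUnit.unit)
      (fun g g' h => ha.mono PUnit.unit g g' h)
      (fun g h => ha.naturality PUnit.unit PUnit.unit (InducedCategory.homMk h) g)
    refine ⟨t, fun _ g => ht g, fun t' ht' => ?_⟩
    have h : ∀ g, t' ≫ g = t ≫ g := fun g => (ht' PUnit.unit g).trans (ht g).symm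
    exact (le_of_generator hX fun g => (h g).le).antisymm (le_of_generator hX fun g => (h g).ge)
  le_of_comp_le A t t' h := le_of_generator hX fun g => h PUnit.unit g

theorem map_eta_comp {C : Type u₁} [Category.{v₁} C] (T : Monad C) {X Y : C}
    (h : T.obj X ⟶ T.obj Y) (hh : T.map h ≫ T.μ.app Y = T.μ.app X ≫ h) :
    T.map (T.η.app X ≫ h) ≫ T.μ.app Y = h := by
  rw [Functor.map_comp, Category.assoc, hh]
  exact T.right_unit_assoc X h

/-- Fullness ensures that a subcategory containing the Kleisli category contains every endomorphism
of the generator. -/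
theorem kleisliToAlgebra_map_surjective {C : Type u₁} [Category.{v₁} C] (T : Monad C)
    {X Y : Kleisli T} (h : T.free.obj X.of ⟶ T.free.obj Y.of) :
    ∃ f : X ⟶ Y, (kleisliToAlgebra T).map f = h := by
  refine ⟨⟨T.η.app X.of ≫ h.f⟩, Monad.Algebra.Hom.ext ?_⟩
  exact map_eta_comp T _ h.h

theorem isOrderFunctor_generatorWeight : IsOrderFunctor (generatorWeight X) :=
  fun _ _ _ _ h _ => OrderEnriched.comp_le_comp (C := FilterAlgebra.{u} k) le_rfl h

theorem xAlg_isWeightedLimitClosure :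
    Subcategory.IsWeightedLimitClosure (kleisliToAlgebra (filterMonad.{u} k)) (xAlg k) := by
  have hfree : ∀ Y : Top0.{u}, IsSierpinskiCogenerated (k := k) ((filterMonad k).free.obj Y) :=
    fun Y => isSierpinskiCogenerated_iff.2 (free_hasClearBasis Y)
  refine ⟨⟨⟨fun Y => hfree Y.of, fun Y Z _ => ⟨hfree Y.of, hfree Z.of⟩⟩,
    xAlg_closedUnderWeightedLimits⟩, ?_⟩
  rintro B ⟨hB, hBc⟩
  have hD : B.ContainsImage (generatorDiagram k) := by
    refine ⟨fun _ => hB.1 (Kleisli.mk _ _), fun _ _ h => ?_⟩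
    obtain ⟨f, hf⟩ := kleisliToAlgebra_map_surjective (filterMonad k) (X := Kleisli.mk _ _)
      (Y := Kleisli.mk _ _) h.hom
    have := hB.2 _ _ f
    rw [hf] at this
    exact this
  have key := fun {X : FilterAlgebra.{u} k} (hX : IsSierpinskiCogenerated X) =>
    hBc _ (generatorDiagram k) (generatorWeight X) (fun _ _ _ _ h => h)
      isOrderFunctor_generatorWeight hD X _
      (isWeightedLimit_generator (isSierpinskiCogenerated_iff.1 hX))
  -- For `f : X ⟶ Y` and a projection `g` of `Y`, the composite `f ≫ g` is itself a projection of
  -- `X`; the universal property in `B` then yields `f`.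
  exact ⟨fun X hX => (key hX).1, fun X Y f hf =>
    (key hf.2).2.2 X f (key hf.1).1 fun d g => (key hf.1).2.1 d (f ≫ g)⟩

theorem xAlgTop_isWeightedLimitClosure :
    Subcategory.IsWeightedLimitClosure
      (kleisliToAlgebra (filterMonad.{u} k) ⋙ (filterMonad.{u} k).forget) (xAlgTop k) := by
  refine ⟨⟨⟨fun Y => xAlgTop_obj_iff.2 ⟨_, free_hasClearBasis Y.of, rfl⟩, fun Y Z f =>
    xAlgTop_hom_iff.2 ⟨free_hasClearBasis Y.of, free_hasClearBasis Z.of,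
      ((kleisliToAlgebra (filterMonad k)).map f).h⟩⟩, xAlgTop_closedUnderWeightedLimits⟩, ?_⟩
  rintro B ⟨hB, hBc⟩
  have hD : B.ContainsImage (generatorDiagram k ⋙ (filterMonad k).forget) := by
    refine ⟨fun _ => hB.1 (Kleisli.mk _ _), fun _ _ h => ?_⟩
    obtain ⟨f, hf⟩ := kleisliToAlgebra_map_surjective (filterMonad k) (X := Kleisli.mk _ _)
      (Y := Kleisli.mk _ _) h.hom
    have := hB.2 _ _ f
    rw [Functor.comp_map, hf] at this
    exact this
  -- The same weighted limit, carried to spaces by the forgetful functor.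
  have key := fun {X : FilterAlgebra.{u} k} (hX : X.HasClearBasis) =>
    hBc _ (generatorDiagram k ⋙ (filterMonad k).forget) (generatorWeight X) (fun _ _ _ _ h => h)
      isOrderFunctor_generatorWeight hD X.A _
      (isWeightedLimit_forget (isWeightedLimit_generator hX))
  refine ⟨fun X hX => ?_, fun X Y f hf => ?_⟩
  · obtain ⟨X, hX', rfl⟩ := xAlgTop_obj_iff.1 hX
    exact (key hX').1
  · obtain ⟨X, hX, rfl⟩ := xAlgTop_obj_iff.1 ((xAlgTop k).source_mem f hf)
    obtain ⟨Y, hY, rfl⟩ := xAlgTop_obj_iff.1 ((xAlgTop k).target_mem f hf)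
    have hf' := (xAlgTop_hom_iff.1 hf).2.2
    exact (key hY).2.2 X.A f (key hX).1 fun d g =>
      (key hX).2.1 d ((⟨f, hf'⟩ : X ⟶ Y) ≫ g)

end FilterAlgebra

/-! ### From algebras to domains: all filters and proper filters. -/

namespace FilterAlgebra

variable {k : FilterKind}

section Domain

variable {X Y : FilterAlgebra.{u} k}

theorem HasClearBasis.le_iff (hX : X.HasClearBasis) {x y : Specialization X.A.obj} :
    x ≤ y ↔ ∀ U : Opens X.A.obj, X.IsClear U → Specialization.ofEquiv x ∈ U →
      Specialization.ofEquiv y ∈ U := hX.specializes_iff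

theorem mem_of_specialization_le {Z : Type*} [TopologicalSpace Z] {x y : Specialization Z}
    (h : x ≤ y) {U : Opens Z} (hx : Specialization.ofEquiv x ∈ U) : Specialization.ofEquiv y ∈ U :=
  Specializes.mem_open (show Specialization.ofEquiv y ⤳ Specialization.ofEquiv x from h) U.isOpen hx

/-- An open set, as a set of elements of the specialisation order. -/
def specSet {Z : Type*} [TopologicalSpace Z] (U : Opens Z) : Set (Specialization Z) :=
  Specialization.ofEquiv ⁻¹' U

/-- Infima are limits of filters. -/
theorem HasClearBasis.isGLB_lim (hX : X.HasClearBasis) (t : Set (Specialization X.A.obj))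
    (hk : k ≠ .prime) (ht : k ≠ .all → t.Nonempty) :
    IsGLB t (Specialization.toEquiv (X.lim (.principal (Specialization.toEquiv ⁻¹' t) hk ht))) := by
  constructor
  · intro y hy
    exact hX.le_iff.2 fun U _ hxU => OpenFilter.mem_principal.1 (mem_of_lim_mem hxU) hy
  · intro y hy
    refine hX.le_iff.2 fun U hU hyU => hU _ fun x hx => ?_
    exact mem_of_specialization_le (hy hx) hyU

theorem meets_inter {Z : Type*} [TopologicalSpace Z] {d : Set (Specialization Z)}
    (hd : DirectedOn (· ≤ ·) d) (U V : Opens Z)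
    (hU : (Specialization.toEquiv ⁻¹' d ∩ (U : Set Z)).Nonempty)
    (hV : (Specialization.toEquiv ⁻¹' d ∩ (V : Set Z)).Nonempty) :
    (Specialization.toEquiv ⁻¹' d ∩ ((U : Set Z) ∩ V)).Nonempty := by
  obtain ⟨x, hx, hxU⟩ := hU
  obtain ⟨y, hy, hyV⟩ := hV
  obtain ⟨z, hz, hxz, hyz⟩ := hd x hx y hy
  exact ⟨z, hz, mem_of_specialization_le hxz hxU, mem_of_specialization_le hyz hyV⟩

/-- Directed suprema are limits of filters. -/
theorem HasClearBasis.isLUB_lim (hX : X.HasClearBasis) (d : Set (Specialization X.A.obj))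
    (hne : d.Nonempty) (hd : DirectedOn (· ≤ ·) d) :
    IsLUB d (Specialization.toEquiv (X.lim (.meeting (Specialization.toEquiv ⁻¹' d) hne (meets_inter hd)))) := by
  constructor
  · intro y hy
    exact hX.le_iff.2 fun U hU hyU => hU _ ⟨y, hy, hyU⟩
  · intro y hy
    refine hX.le_iff.2 fun U hU hxU => ?_
    obtain ⟨z, hz, hzU⟩ := OpenFilter.mem_meeting.1 (mem_of_lim_mem hxU)
    exact mem_of_specialization_le (hy hz) hzU

/-- Open sets are inaccessible by directed suprema: the supremum is the limit of the filter of open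
sets meeting `d`, and a filter contains every open neighbourhood of its limit. -/
theorem HasClearBasis.meets_of_isLUB_mem (hX : X.HasClearBasis) {d : Set (Specialization X.A.obj)}
    (hne : d.Nonempty) (hd : DirectedOn (· ≤ ·) d) {a : Specialization X.A.obj} (ha : IsLUB d a)
    {U : Opens X.A.obj} (haU : Specialization.ofEquiv a ∈ U) : (d ∩ specSet U).Nonempty := by
  obtain rfl := ha.unique (hX.isLUB_lim d hne hd)
  have h : U ∈ (OpenFilter.meeting (Specialization.toEquiv ⁻¹' d) hne (meets_inter hd) :
    OpenFilter k X.A.obj) := mem_of_lim_mem haU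
  exact h

/-- The infimum of `U` is the limit of the principal filter of `U`, hence lies in the clear set `U`.
-/
theorem HasClearBasis.exists_isLeast (hX : X.HasClearBasis) (hk : k ≠ .prime) {U : Opens X.A.obj}
    (hU : X.IsClear U) (hne : k ≠ .all → (U : Set X.A.obj).Nonempty) :
    ∃ c : Specialization X.A.obj, IsLeast (specSet U) c :=
  ⟨_, hU _ (OpenFilter.mem_principal.2 subset_rfl), (hX.isGLB_lim (specSet U) hk hne).1⟩

/-- The elements below `x` that generate a clear principal filter. -/
def clearBelow (x : Specialization X.A.obj) : Set (Specialization X.A.obj) :=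
  {c | c ≤ x ∧ ∃ U : Opens X.A.obj, X.IsClear U ∧ IsLeast (specSet U) c}

theorem HasClearBasis.exists_clearBelow (hX : X.HasClearBasis) (hk : k ≠ .prime)
    {x : Specialization X.A.obj} {U : Opens X.A.obj} (hU : X.IsClear U)
    (hx : Specialization.ofEquiv x ∈ U) : ∃ c ∈ clearBelow x, Specialization.ofEquiv c ∈ U := by
  obtain ⟨c, hc⟩ := hX.exists_isLeast hk hU fun _ => ⟨_, hx⟩
  exact ⟨c, ⟨hc.2 hx, U, hU, hc⟩, hc.1⟩

theorem HasClearBasis.clearBelow_nonempty (hX : X.HasClearBasis) (hk : k ≠ .prime)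
    (x : Specialization X.A.obj) : (clearBelow x).Nonempty := by
  obtain ⟨c, hc, -⟩ := hX.exists_clearBelow hk (x := x) isClear_top trivial
  exact ⟨c, hc⟩

theorem HasClearBasis.directedOn_clearBelow (hX : X.HasClearBasis) (hk : k ≠ .prime)
    (x : Specialization X.A.obj) : DirectedOn (· ≤ ·) (clearBelow x) := by
  rintro c ⟨hcx, U, hU, hc⟩ c' ⟨hcx', U', hU', hc'⟩
  obtain ⟨b, hb, hbU, hbU'⟩ := hX.exists_clearBelow hk (hU.inf hU')
    ⟨mem_of_specialization_le hcx hc.1, mem_of_specialization_le hcx' hc'.1⟩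
  exact ⟨b, hb, hc.2 hbU, hc'.2 hbU'⟩

theorem HasClearBasis.isLUB_clearBelow (hX : X.HasClearBasis) (hk : k ≠ .prime)
    (x : Specialization X.A.obj) : IsLUB (clearBelow x) x := by
  refine ⟨fun c hc => hc.1, fun b hb => hX.le_iff.2 fun U hU hxU => ?_⟩
  obtain ⟨c, hc, hcU⟩ := hX.exists_clearBelow hk hU hxU
  exact mem_of_specialization_le (hb hc) hcU

/-- A compact `c` is the directed supremum of `clearBelow c`, hence one of its members. Conversely,
the least element of an open set is compact because open sets are inaccessible by directed suprema.
-/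
theorem HasClearBasis.compact_eq_clearBelow (hX : X.HasClearBasis) (hk : k ≠ .prime)
    (x : Specialization X.A.obj) : {y | y ≤ x ∧ IsCompactElement y} = clearBelow x := by
  ext c
  refine and_congr_right fun _ => ⟨fun hc => ?_, ?_⟩
  · obtain ⟨b, hb, hcb⟩ := hc _ _ (hX.clearBelow_nonempty hk c) (hX.directedOn_clearBelow hk c)
      (hX.isLUB_clearBelow hk c) le_rfl
    obtain rfl := le_antisymm hcb hb.1
    exact hb.2
  · rintro ⟨U, -, hc⟩ d a hne hd ha hca
    obtain ⟨y, hy, hyU⟩ := hX.meets_of_isLUB_mem hne hd ha (mem_of_specialization_le hca hc.1)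
    exact ⟨y, hy, hc.2 hyU⟩

theorem HasClearBasis.isAlgebraicDomain (hX : X.HasClearBasis) (hk : k ≠ .prime) :
    IsAlgebraicDomain (Specialization X.A.obj) where
  exists_isLUB d hne hd := ⟨_, hX.isLUB_lim d hne hd⟩
  nonempty_compact x := hX.compact_eq_clearBelow hk x ▸ hX.clearBelow_nonempty hk x
  directed_compact x := hX.compact_eq_clearBelow hk x ▸ hX.directedOn_clearBelow hk x
  isLUB_compact x := hX.compact_eq_clearBelow hk x ▸ hX.isLUB_clearBelow hk x

/-- The supremum is the infimum of the upper bounds; for proper filters boundedness makes that set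
nonempty. -/
theorem HasClearBasis.exists_isLUB (hX : X.HasClearBasis) (hk : k ≠ .prime)
    (s : Set (Specialization X.A.obj)) (hs : k ≠ .all → BddAbove s) : ∃ a, IsLUB s a :=
  ⟨_, isGLB_upperBounds.1 (hX.isGLB_lim (upperBounds s) hk hs)⟩

theorem isOpen_scott_iff {α : Type*} [Preorder α] {s : Set α} :
    IsOpen[Topology.scott α Set.univ] s ↔ IsUpperSet s ∧ DirSupInacc s := by
  rw [← dirSupInaccOn_univ]
  exact @Topology.IsScott.isOpen_iff_isUpperSet_and_dirSupInaccOn α Set.univ _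
    (Topology.scott α Set.univ) s
    (@Topology.IsScott.mk α Set.univ _ (Topology.scott α Set.univ) rfl)

theorem isScottSpace_iff {X : Top0.{u}} : X.IsScottSpace ↔ ∀ s : Set X.obj, IsOpen s ↔
    IsUpperSet (α := Specialization X.obj) s ∧ DirSupInacc (α := Specialization X.obj) s := by
  constructor
  · rintro ⟨h⟩ s
    exact (iff_of_eq (congrArg (fun τ => IsOpen[τ] s) h)).trans
      (@isOpen_scott_iff X.obj (specializationPreorder X.obj) s)
  · intro h
    refine @Topology.IsScott.mk _ _ (specializationPreorder X.obj) _ (TopologicalSpace.ext ?_)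
    exact funext fun s => propext ((h s).trans
      (@isOpen_scott_iff X.obj (specializationPreorder X.obj) s).symm)

theorem HasClearBasis.isScottSpace (hX : X.HasClearBasis) (hk : k ≠ .prime) :
    X.A.IsScottSpace := by
  refine isScottSpace_iff.2 fun V => ⟨fun hV => ⟨fun x y hxy hx => ?_, fun d hne hd a ha haV => ?_⟩,
    fun ⟨hup, hV⟩ => isOpen_iff_forall_mem_open.2 fun x hx => ?_⟩
  · exact mem_of_specialization_le (U := ⟨V, hV⟩) hxy hx
  · exact hX.meets_of_isLUB_mem (U := ⟨V, hV⟩) hne hd ha haV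
  · obtain ⟨c, ⟨hcx, U, -, hc⟩, hcV⟩ := hV (hX.clearBelow_nonempty hk x)
      (hX.directedOn_clearBelow hk x) (hX.isLUB_clearBelow hk x) hx
    exact ⟨U, fun y hy => hup (hc.2 hy) hcV, U.isOpen, mem_of_specialization_le hcx hc.1⟩

/-- The homomorphisms are the maps that preserve directed suprema and (nonempty) infima. -/
theorem hom_iff (hX : X.HasClearBasis) (hY : Y.HasClearBasis) (hk : k ≠ .prime) {f : X.A ⟶ Y.A} :
    (filterMonad k).map f ≫ Y.a = X.a ≫ f ↔ ScottContinuous (Top0.specMap f) ∧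
      ∀ (s : Set (Specialization X.A.obj)) (a : Specialization X.A.obj), (k ≠ .all → s.Nonempty) →
        IsGLB s a → IsGLB (Top0.specMap f '' s) (Top0.specMap f a) := by
  constructor
  · intro h
    have hf := hom_lim (X := X) (Y := Y) ⟨f, h⟩
    constructor
    · intro d hne hd a ha
      obtain rfl := ha.unique (hX.isLUB_lim d hne hd)
      have hd' : DirectedOn (· ≤ ·) (Top0.specMap f '' d) :=
        directedOn_image.2 (hd.mono fun {_ _} h => (Top0.specMap f).monotone h)
      convert hY.isLUB_lim _ (hne.image _) hd' using 1
      refine (hf _).trans (congrArg Y.lim (OpenFilter.ext fun U => ?_))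
      exact (Set.image_inter_nonempty_iff (f := Top0.toMap f) (s := d) (t := (U : Set Y.A.obj))).symm
    · intro s a hs ha
      obtain rfl := ha.unique (hX.isGLB_lim s hk hs)
      convert hY.isGLB_lim (Top0.specMap f '' s) hk (fun h => (hs h).image _) using 1
      refine (hf _).trans (congrArg Y.lim (OpenFilter.ext fun U => ?_))
      exact (Set.image_subset_iff (f := Top0.toMap f) (s := s) (t := (U : Set Y.A.obj))).symm
  · rintro ⟨-, hglb⟩
    refine (hY.homMk f fun V hV => ?_).h
    -- The infimum `m` of the preimage of `V` exists unless filters must be proper and the preimage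
    -- is empty; the empty set is then clear anyway.
    by_cases hne : k ≠ .all → ((Opens.comap (Top0.toMap f) V : Opens _) : Set X.A.obj).Nonempty
    · obtain ⟨c, hc⟩ := hY.exists_isLeast hk hV fun h => by
        obtain ⟨x, hx⟩ := hne h
        exact ⟨_, hx⟩
      have hm := hX.isGLB_lim (specSet (Opens.comap (Top0.toMap f) V)) hk hne
      generalize Specialization.toEquiv (X.lim _) = m at hm
      have hcm : c ≤ Top0.specMap f m := (hglb _ m hne hm).2 (by
        rintro _ ⟨x, hx, rfl⟩
        exact hc.2 hx)
      -- Since `f` preserves the infimum, `m` lies in the preimage and is its least element, so any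
      -- clear neighbourhood of `m` inside the preimage is all of it.
      obtain ⟨W, hW, hmW, hWU⟩ := hX m (Opens.comap (Top0.toMap f) V)
        (mem_of_specialization_le hcm hc.1)
      rwa [show Opens.comap (Top0.toMap f) V = W from
        le_antisymm (fun x hx => mem_of_specialization_le (hm.1 hx) hmW) hWU]
    · push Not at hne
      rw [show Opens.comap (Top0.toMap f) V = ⊥ from Opens.ext hne.2]
      exact isClear_bot hne.1

end Domain

/-! ### From domains to algebras. -/

section OfDomain

variable {X : Top0.{u}}

/-- A point of a Scott open set lies above a compact element of that set. -/
theorem exists_compact_mem (hX : X.IsScottSpace) (hd : IsAlgebraicDomain (Specialization X.obj))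
    {x : Specialization X.obj} {V : Set X.obj} (hV : IsOpen V) (hx : x ∈ V) :
    ∃ c : Specialization X.obj, c ≤ x ∧ IsCompactElement c ∧ c ∈ V := by
  obtain ⟨c, hc, hcV⟩ := ((isScottSpace_iff.1 hX V).1 hV).2 (hd.nonempty_compact x)
    (hd.directed_compact x) (hd.isLUB_compact x) hx
  exact ⟨c, hc.1, hc.2, hcV⟩

theorem isOpen_Ici_of_isCompactElement (hX : X.IsScottSpace) {c : Specialization X.obj}
    (hc : IsCompactElement c) : IsOpen (Specialization.toEquiv ⁻¹' Set.Ici c) := by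
  refine (isScottSpace_iff.1 hX _).2 ⟨isUpperSet_Ici c, fun d hne hd a ha hca => ?_⟩
  obtain ⟨x, hx, hcx⟩ := hc d a hne hd ha hca
  exact ⟨x, hx, hcx⟩

/-- The open set of elements above a compact element. -/
def compactOpen (hX : X.IsScottSpace) (c : {c : Specialization X.obj // IsCompactElement c}) :
    Opens X.obj := ⟨Specialization.toEquiv ⁻¹' Set.Ici c.1, isOpen_Ici_of_isCompactElement hX c.2⟩

theorem str_eq_generateFrom_compactOpen (hX : X.IsScottSpace)
    (hd : IsAlgebraicDomain (Specialization X.obj)) :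
    X.obj.str = generateFrom (Set.range fun c => (compactOpen hX c : Set X.obj)) := by
  refine (isTopologicalBasis_of_isOpen_of_nhds ?_ ?_).eq_generateFrom
  · rintro _ ⟨c, rfl⟩
    exact (compactOpen hX c).isOpen
  · intro x V hx hV
    obtain ⟨c, hcx, hc, hcV⟩ := exists_compact_mem hX hd hV hx
    exact ⟨_, ⟨⟨c, hc⟩, rfl⟩, hcx, fun y hy => mem_of_specialization_le (U := ⟨V, hV⟩) hy hcV⟩

theorem IsCompactElement.of_isLUB_pair {α : Type*} [PartialOrder α] {a b c : α}
    (ha : IsCompactElement a) (hb : IsCompactElement b) (hc : IsLUB {a, b} c) :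
    IsCompactElement c := by
  intro s u hne hs hu hcu
  obtain ⟨x, hx, hax⟩ := ha s u hne hs hu ((hc.1 (by simp)).trans hcu)
  obtain ⟨y, hy, hby⟩ := hb s u hne hs hu ((hc.1 (by simp)).trans hcu)
  obtain ⟨z, hz, hxz, hyz⟩ := hs x hx y hy
  refine ⟨z, hz, hc.2 ?_⟩
  rintro _ (rfl | rfl)
  exacts [hax.trans hxz, hby.trans hyz]

/-- The limit is the supremum of the compact elements whose upper sets belong to `𝔣`. Directedness
uses binary suprema: two such upper sets meet in a member of `𝔣`, which is inhabited when `𝔣` is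
proper, so the pair is bounded. -/
theorem exists_lim_of_isAlgebraicDomain (hX : X.IsScottSpace)
    (hd : IsAlgebraicDomain (Specialization X.obj))
    (hsup : ∀ s : Set (Specialization X.obj), (k ≠ .all → BddAbove s) → ∃ a, IsLUB s a)
    (𝔣 : OpenFilter k X.obj) : ∃ x : X.obj, ∀ c, x ∈ compactOpen hX c ↔ compactOpen hX c ∈ 𝔣 := by
  let s : Set (Specialization X.obj) := {c | ∃ hc : IsCompactElement c, compactOpen hX ⟨c, hc⟩ ∈ 𝔣}
  have hinh : ∀ U : Opens X.obj, U ∈ 𝔣 → k ≠ .all → ∃ x, x ∈ U := by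
    intro U hU hk
    by_contra! h
    exact 𝔣.bot_notMem hk (OpenFilter.mem_of_le (fun x hx => h x hx) hU)
  have hne : s.Nonempty := by
    -- The supremum of the empty set is a bottom element, which is compact. For proper filters the
    -- existence of `𝔣` itself excludes the empty domain.
    obtain ⟨m, hm⟩ := hsup ∅ fun hk => by
      obtain ⟨x, -⟩ := hinh ⊤ 𝔣.top_mem hk
      exact ⟨x, fun y hy => hy.elim⟩
    have hm' : ∀ x, m ≤ x := fun x => hm.2 fun y hy => hy.elim
    have hc : IsCompactElement m := fun d _ ⟨x, hx⟩ _ _ _ => ⟨x, hx, hm' x⟩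
    exact ⟨m, hc, OpenFilter.mem_of_le (fun x _ => hm' x) 𝔣.top_mem⟩
  have hdir : DirectedOn (· ≤ ·) s := by
    rintro a ⟨ha, ha𝔣⟩ b ⟨hb, hb𝔣⟩
    have hab := OpenFilter.inf_mem ha𝔣 hb𝔣
    obtain ⟨m, hm⟩ := hsup {a, b} fun hk => by
      obtain ⟨x, hax, hbx⟩ := hinh _ hab hk
      refine ⟨x, ?_⟩
      rintro _ (rfl | rfl)
      exacts [hax, hbx]
    refine ⟨m, ⟨IsCompactElement.of_isLUB_pair ha hb hm, OpenFilter.mem_of_le ?_ hab⟩,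
      hm.1 (by simp), hm.1 (by simp)⟩
    rintro x ⟨hax, hbx⟩
    refine hm.2 ?_
    rintro _ (rfl | rfl)
    exacts [hax, hbx]
  obtain ⟨x, hx⟩ := hd.exists_isLUB s hne hdir
  refine ⟨x, fun c => ⟨fun hc => ?_, fun hc => hx.1 ⟨c.2, hc⟩⟩⟩
  obtain ⟨b, ⟨hb, hb𝔣⟩, hcb⟩ := c.2 s x hne hdir hx hc
  exact OpenFilter.mem_of_le (fun y hy => le_trans hcb hy) hb𝔣

theorem xAlgTop_obj_iff_of_ne_prime (hk : k ≠ .prime) : (xAlgTop k).obj X ↔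
    X.IsScottSpace ∧ IsAlgebraicDomain (Specialization X.obj) ∧
      ∀ s : Set (Specialization X.obj), (k ≠ .all → BddAbove s) → ∃ a, IsLUB s a := by
  rw [xAlgTop_obj_iff]
  constructor
  · rintro ⟨X, hX, rfl⟩
    exact ⟨hX.isScottSpace hk, hX.isAlgebraicDomain hk, hX.exists_isLUB hk⟩
  · rintro ⟨hX, hd, hsup⟩
    choose l hl using exists_lim_of_isAlgebraicDomain (k := k) hX hd hsup
    exact ⟨ofSubbasis X _ (str_eq_generateFrom_compactOpen hX hd) l hl,
      ofSubbasis_hasClearBasis _ _ _ _ _, rfl⟩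

theorem xAlgTop_hom_iff_of_ne_prime (hk : k ≠ .prime) {Y : Top0.{u}} {f : X ⟶ Y} :
    (xAlgTop k).hom f ↔ (xAlgTop k).obj X ∧ (xAlgTop k).obj Y ∧ ScottContinuous (Top0.specMap f) ∧
      ∀ (s : Set (Specialization X.obj)) (a : Specialization X.obj), (k ≠ .all → s.Nonempty) →
        IsGLB s a → IsGLB (Top0.specMap f '' s) (Top0.specMap f a) := by
  constructor
  · intro hf
    have hX := (xAlgTop k).source_mem f hf
    have hY := (xAlgTop k).target_mem f hf
    refine ⟨hX, hY, ?_⟩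
    obtain ⟨X, hX', rfl⟩ := xAlgTop_obj_iff.1 hX
    obtain ⟨Y, hY', rfl⟩ := xAlgTop_obj_iff.1 hY
    exact (hom_iff hX' hY' hk).1 (xAlgTop_hom_iff.1 hf).2.2
  · rintro ⟨hX, hY, hf⟩
    obtain ⟨X, hX', rfl⟩ := xAlgTop_obj_iff.1 hX
    obtain ⟨Y, hY', rfl⟩ := xAlgTop_obj_iff.1 hY
    exact xAlgTop_hom_iff.2 ⟨hX', hY', (hom_iff hX' hY' hk).2 hf⟩

end OfDomain

theorem xAlgTop_all : xAlgTop.{u} .all = algLat := by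
  have hobj : ∀ X : Top0.{u}, (xAlgTop .all).obj X ↔
      X.IsScottSpace ∧ IsAlgebraicLattice (Specialization X.obj) := fun X => by
    rw [xAlgTop_obj_iff_of_ne_prime (by simp)]
    refine and_congr_right fun _ => ⟨fun ⟨h, h'⟩ => ?_, fun h => ⟨h.toIsAlgebraicDomain,
      fun s _ => h.exists_isLUB_all s⟩⟩
    exact { h with
      exists_isLUB_all := fun s => h' s (by simp)
      exists_isGLB_all := fun s => (h' (lowerBounds s) (by simp)).imp fun _ => isLUB_lowerBounds.1 }
  refine Subcategory.ext (funext fun X => propext (hobj X)) ?_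
  ext X Y f
  rw [xAlgTop_hom_iff_of_ne_prime (by simp), hobj, hobj]
  simp [algLat]

theorem xAlgTop_proper : xAlgTop.{u} .proper = algDom := by
  have hobj : ∀ X : Top0.{u}, (xAlgTop .proper).obj X ↔
      X.IsScottSpace ∧ IsBoundedCompleteAlgebraicDomain (Specialization X.obj) := fun X => by
    rw [xAlgTop_obj_iff_of_ne_prime (by simp)]
    refine and_congr_right fun _ => ⟨fun ⟨h, h'⟩ => ?_, fun h => ⟨h.toIsAlgebraicDomain,
      fun s hs => h.exists_isLUB_of_bddAbove s (hs (by simp))⟩⟩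
    exact { h with exists_isLUB_of_bddAbove := fun s hs => h' s fun _ => hs }
  refine Subcategory.ext (funext fun X => propext (hobj X)) ?_
  ext X Y f
  rw [xAlgTop_hom_iff_of_ne_prime (by simp), hobj, hobj]
  simp only [algDom, ne_eq, reduceCtorEq, not_false_eq_true, forall_const]

/-! ### Prime filters and spectral spaces. -/

section Spectral

variable {X Y : FilterAlgebra.{u} .prime}

/-- For prime filters finite unions of clear sets are clear, and a compact open set is a finite
union of basic clear sets. -/
theorem HasClearBasis.isClear_iff_isCompact (hX : X.HasClearBasis) {U : Opens X.A.obj} :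
    X.IsClear U ↔ IsCompact (U : Set X.A.obj) := by
  refine ⟨fun h => h.isCompact, fun h => ?_⟩
  obtain ⟨V, hV, hUV, hVU⟩ := h.induction_on
    (p := fun s => ∃ V, X.IsClear V ∧ s ⊆ V ∧ V ≤ U)
    ⟨⊥, isClear_bot (by simp), Set.empty_subset _, bot_le⟩
    (fun s s' hs ⟨V, hV, hV', hVU⟩ => ⟨V, hV, hs.trans hV', hVU⟩)
    (fun s s' ⟨V, hV, hV', hVU⟩ ⟨V₂, hV₂, hV₂', hVU₂⟩ => ⟨V ⊔ V₂, hV.sup rfl hV₂,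
      Set.union_subset_union hV' hV₂', sup_le hVU hVU₂⟩)
    (fun x hx => by
      obtain ⟨V, hV, hxV, hVU⟩ := hX x U hx
      exact ⟨V, mem_nhdsWithin_of_mem_nhds (V.isOpen.mem_nhds hxV), V, hV, subset_rfl, hVU⟩)
  rwa [le_antisymm (a := U) hUV hVU]

theorem HasClearBasis.spectralSpace (hX : X.HasClearBasis) : SpectralSpace X.A.obj where
  toT0Space := inferInstance
  isCompact_univ := isClear_top.isCompact
  sober {Z} hZ hZc := by
    have hmeet : ∀ U V : Opens X.A.obj, (Z ∩ U).Nonempty → (Z ∩ V).Nonempty →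
        (Z ∩ (U ∩ V)).Nonempty := fun U V => hZ.2 U V U.isOpen V.isOpen
    -- Irreducibility makes the open sets meeting `Z` a prime filter; its limit is the generic
    -- point.
    refine ⟨X.lim (.meeting Z hZ.1 hmeet), ?_⟩
    refine subset_antisymm ?_ fun z hz => mem_closure_iff.2 fun V hV hzV => ?_
    · refine closure_minimal (Set.singleton_subset_iff.2 ?_) hZc
      by_contra h
      obtain ⟨x, hx, hx'⟩ := OpenFilter.mem_meeting.1
        (mem_of_lim_mem (U := ⟨Zᶜ, hZc.isOpen_compl⟩) h)
      exact hx' hx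
    · obtain ⟨U, hU, hzU, hUV⟩ := hX z ⟨V, hV⟩ hzV
      exact ⟨_, hUV (hU _ (OpenFilter.mem_meeting.2 ⟨z, hz, hzU⟩)), rfl⟩
  inter_isCompact U V hUo hU hVo hV :=
    ((hX.isClear_iff_isCompact (U := ⟨U, hUo⟩).2 hU).inf
      (hX.isClear_iff_isCompact (U := ⟨V, hVo⟩).2 hV)).isCompact
  isTopologicalBasis := isTopologicalBasis_of_isOpen_of_nhds (fun _ h => h.1) fun x V hx hV => by
    obtain ⟨U, hU, hxU, hUV⟩ := hX x ⟨V, hV⟩ hx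
    exact ⟨U, ⟨U.isOpen, hU.isCompact⟩, hxU, hUV⟩

/-- The set `Z` of points all of whose compact open neighbourhoods belong to `𝔣` is closed, and
compactness with primality shows that it meets every compact open member of `𝔣`. Hence it is
irreducible, and the limit is its generic point. -/
theorem exists_lim_of_spectralSpace {X : Type u} [TopologicalSpace X] [SpectralSpace X]
    (𝔣 : OpenFilter .prime X) :
    ∃ x : X, ∀ U : Opens X, IsCompact (U : Set X) → (x ∈ U ↔ U ∈ 𝔣) := by
  let Z : Set X := {z | ∀ V : Opens X, IsCompact (V : Set X) → z ∈ V → V ∈ 𝔣}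
  have hmeets : ∀ U : Opens X, IsCompact (U : Set X) → U ∈ 𝔣 → (Z ∩ U).Nonempty := by
    intro W hW hW𝔣
    by_contra hne
    obtain ⟨V, hV𝔣, hWV⟩ := hW.induction_on (p := fun s => ∃ V : Opens X, V ∉ 𝔣 ∧ s ⊆ V)
      ⟨⊥, 𝔣.bot_notMem (by simp), Set.empty_subset _⟩
      (fun s s' hs ⟨V, hV, hV'⟩ => ⟨V, hV, hs.trans hV'⟩)
      (fun s s' ⟨V, hV, hV'⟩ ⟨V₂, hV₂, hV₂'⟩ => ⟨V ⊔ V₂,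
        fun h => (𝔣.mem_or_mem rfl V V₂ h).elim hV hV₂, Set.union_subset_union hV' hV₂'⟩)
      (fun x hx => by
        have hxZ : x ∉ Z := fun hxZ => hne ⟨x, hxZ, hx⟩
        obtain ⟨V, -, hxV, hV𝔣⟩ : ∃ V : Opens X, IsCompact (V : Set X) ∧ x ∈ V ∧ V ∉ 𝔣 := by
          simpa [Z] using hxZ
        exact ⟨V, mem_nhdsWithin_of_mem_nhds (V.isOpen.mem_nhds hxV), V, hV𝔣, subset_rfl⟩)
    exact hV𝔣 (OpenFilter.mem_of_le hWV hW𝔣)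
  have hZc : IsClosed Z := by
    have : Z = ⋂ V ∈ {V : Opens X | IsCompact (V : Set X) ∧ V ∉ 𝔣}, (V : Set X)ᶜ := by
      ext z
      simp only [Set.mem_iInter, Set.mem_compl_iff]
      exact ⟨fun h V hV hz => hV.2 (h V hV.1 hz), fun h V hV hz => by
        by_contra hV𝔣
        exact h V ⟨hV, hV𝔣⟩ hz⟩
    rw [this]
    exact isClosed_biInter fun V _ => V.isOpen.isClosed_compl
  have hshrink : ∀ V : Set X, IsOpen V → (Z ∩ V).Nonempty →
      ∃ U : Opens X, IsCompact (U : Set X) ∧ (U : Set X) ⊆ V ∧ U ∈ 𝔣 := by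
    rintro V hV ⟨z, hz, hzV⟩
    obtain ⟨U, ⟨hUo, hU⟩, hzU, hUV⟩ :=
      (PrespectralSpace.isTopologicalBasis (X := X)).exists_subset_of_mem_open hzV hV
    exact ⟨⟨U, hUo⟩, hU, hUV, hz ⟨U, hUo⟩ hU hzU⟩
  have hZ : IsIrreducible Z := by
    refine ⟨by simpa using hmeets ⊤ isCompact_univ 𝔣.top_mem, fun U V hU hV hZU hZV => ?_⟩
    obtain ⟨U', hU', hUU, hU𝔣⟩ := hshrink U hU hZU
    obtain ⟨V', hV', hVV, hV𝔣⟩ := hshrink V hV hZV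
    exact (hmeets (U' ⊓ V') (QuasiSeparatedSpace.inter_isCompact _ _ U'.isOpen hU' V'.isOpen hV')
      (OpenFilter.inf_mem hU𝔣 hV𝔣)).mono
      (Set.inter_subset_inter_right _ (Set.inter_subset_inter hUU hVV))
  obtain ⟨x, hx⟩ := QuasiSober.sober hZ hZc
  have hxZ : x ∈ Z := hx.mem
  refine ⟨x, fun U hU => ⟨fun h => hxZ U hU h, fun h => ?_⟩⟩
  obtain ⟨z, hz, hzU⟩ := hmeets U hU h
  exact (hx.specializes hz).mem_open U.isOpen hzU

theorem xAlgTop_prime_obj_iff {X : Top0.{u}} :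
    (xAlgTop .prime).obj X ↔ SpectralSpace X.obj := by
  rw [xAlgTop_obj_iff]
  constructor
  · rintro ⟨X, hX, rfl⟩
    exact hX.spectralSpace
  · intro h
    choose l hl using exists_lim_of_spectralSpace (X := X.obj)
    refine ⟨ofSubbasis X (fun U : {U : Opens X.obj // IsCompact (U : Set X.obj)} => U.1) ?_ l
      fun 𝔣 U => hl 𝔣 U.1 U.2, ofSubbasis_hasClearBasis _ _ _ _ _, rfl⟩
    refine (isTopologicalBasis_of_isOpen_of_nhds ?_ fun x V hx hV => ?_).eq_generateFrom
    · rintro _ ⟨U, rfl⟩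
      exact U.1.isOpen
    · obtain ⟨U, ⟨hUo, hU⟩, hxU, hUV⟩ :=
        (PrespectralSpace.isTopologicalBasis (X := X.obj)).exists_subset_of_mem_open hx hV
      exact ⟨U, ⟨⟨⟨U, hUo⟩, hU⟩, rfl⟩, hxU, hUV⟩

theorem hom_iff_isSpectralMap (hX : X.HasClearBasis) (hY : Y.HasClearBasis) {f : X.A ⟶ Y.A} :
    (filterMonad .prime).map f ≫ Y.a = X.a ≫ f ↔ IsSpectralMap (Top0.toMap f) := by
  constructor
  · intro h
    refine ⟨(Top0.toMap f).continuous, fun U hUo hU => ?_⟩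
    exact ((hY.isClear_iff_isCompact (U := ⟨U, hUo⟩).2 hU).comap (X := X) ⟨f, h⟩).isCompact
  · intro h
    exact (hY.homMk f fun U hU => hX.isClear_iff_isCompact.2
      (h.isCompact_preimage_of_isOpen U.isOpen hU.isCompact)).h

theorem xAlgTop_prime : xAlgTop.{u} .prime = spec := by
  refine Subcategory.ext (funext fun X => propext xAlgTop_prime_obj_iff) ?_
  ext X Y f
  constructor
  · intro hf
    obtain ⟨X, hX, rfl⟩ := xAlgTop_obj_iff.1 ((xAlgTop .prime).source_mem f hf)
    obtain ⟨Y, hY, rfl⟩ := xAlgTop_obj_iff.1 ((xAlgTop .prime).target_mem f hf)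
    exact ⟨hX.spectralSpace, hY.spectralSpace,
      (hom_iff_isSpectralMap hX hY).1 (xAlgTop_hom_iff.1 hf).2.2⟩
  · rintro ⟨hX, hY, hf⟩
    obtain ⟨X, hX', rfl⟩ := xAlgTop_obj_iff.1 (xAlgTop_prime_obj_iff.2 hX)
    obtain ⟨Y, hY', rfl⟩ := xAlgTop_obj_iff.1 (xAlgTop_prime_obj_iff.2 hY)
    exact xAlgTop_hom_iff.2 ⟨hX', hY', (hom_iff_isSpectralMap hX' hY').2 hf⟩

end Spectral

end FilterAlgebra

theorem mainTheorem4 :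
    (xAlgTop.{u} .all = algLat ∧ xAlgTop.{u} .proper = algDom ∧ xAlgTop.{u} .prime = spec) ∧
    ∀ k : FilterKind,
      Subcategory.IsWeightedLimitClosure (kleisliToAlgebra (filterMonad.{u} k)) (xAlg k) ∧
      Subcategory.IsWeightedLimitClosure
        (kleisliToAlgebra (filterMonad.{u} k) ⋙ (filterMonad.{u} k).forget) (xAlgTop k) :=
  ⟨⟨FilterAlgebra.xAlgTop_all, FilterAlgebra.xAlgTop_proper, FilterAlgebra.xAlgTop_prime⟩,
    fun _ => ⟨FilterAlgebra.xAlg_isWeightedLimitClosure,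
      FilterAlgebra.xAlgTop_isWeightedLimitClosure⟩⟩
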